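/- Conventions. "Noetherian" means left and right noetherian; modules are right modules unless said otherwise. Let $R$ be a semiperfect noetherian ring which is basic, i.e. $1=f_1+\dots+f_n$ for pairwise orthogonal primitive idempotents $f_i$ with $f_iR\not\cong f_jR$ for $i\neq j$. Let $e\in R$ be a nonzero idempotent and put $\Gamma_e:=(1-e)R(1-e)$ and $S_e:=eR/\operatorname{rad}(eR)$; let $\langle 1-e\rangle$ be the two-sided ideal generated by $1-e$. For a module $M$ let $\mathsf{add}\,M$ be the class of direct summands of finite direct sums of copies of $M$. For modules $M,M'$ put $$m(M,M'):=\sup\{k\in\mathbb N : \operatorname{Ext}^k_R(M,M')\neq 0\}\in\mathbb N\cup\{\pm\infty\}.$$ We say that $S_e$ has the $m$-property if there is $N\in\mathbb N$ with $m(X,X')\le N$ for all $X,X'\in\mathsf{add}\,S_e$, and every nonzero $X\in\mathsf{add}\,S_e$ has a nonzero $m$-dual, i.e. a nonzero $X'\in\mathsf{add}\,S_e$ with $m(X'',X')\le m(X,X')$ for all $X''\in\mathsf{add}\,S_e$. Let $Y_e:=\bigoplus_{k\ge 0}\operatorname{Ext}^k_R(S_e,S_e)$ be the graded Yoneda ring,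 where the product $xy$ is the composite "first $x$, then $y$". We say that $Y_e$ has uniformly graded Loewy length if the indecomposable graded projective right modules $fY_e$, for $f$ a primitive idempotent of degree $0$, all have the same finite graded length $\sup\{k+1 : f\operatorname{Ext}^k_R(S_e,S_e)\neq 0\}$. Theorem. Assume that the ring $R/\langle 1-e\rangle$ is right artinian, that $S_e$ has the $m$-property, and that $\operatorname{Tor}_k^{\Gamma_e}(eR(1-e),(1-e)Re)=0$ for all but finitely many $k\in\mathbb N$. Then: (1) there is a nonzero $S\in\mathsf{add}\,S_e$ with $\operatorname{Ext}^k_R(S_e,S)=0$ for all $k>0$; (2) if $Y_e$ has uniformly graded Loewy length, then (1) holds for $S=S_e$; that is, $S_e\neq 0$ and $\operatorname{Ext}^k_R(S_e,S_e)=0$ for all $k>0$. -/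

import Mathlib

open CategoryTheory MulOpposite
open scoped TensorProduct

universe u

noncomputable section

/-! Conventions: right modules over a ring `R` are modules over `Rᵐᵒᵖ`, and right multiplication
by `r` is `MulOpposite.op r • x = x * r`. -/

/-! ### Semiperfect and basic rings -/

/-- A ring is semiperfect if it is semisimple modulo its Jacobson radical and idempotents lift
modulo the Jacobson radical. -/
structure IsSemiperfectRing (R : Type u) [Ring R] : Prop where
  isSemisimpleRing_quotient : IsSemisimpleRing (R ⧸ Ring.jacobson R)
  exists_lift : ∀ x : R, x * x - x ∈ Ring.jacobson R →
    ∃ f : R, IsIdempotentElem f ∧ f - x ∈ Ring.jacobson R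

/-- A primitive idempotent: a nonzero idempotent which is not the sum of two nonzero orthogonal
idempotents. -/
structure IsPrimitiveIdempotent {A : Type*} [Semiring A] (f : A) : Prop where
  isIdempotentElem : IsIdempotentElem f
  ne_zero : f ≠ 0
  eq_zero_or_eq_zero : ∀ g h : A, IsIdempotentElem g → IsIdempotentElem h →
    g * h = 0 → h * g = 0 → f = g + h → g = 0 ∨ h = 0

/-- The right ideal `eR`. -/
def rightIdeal {R : Type u} [Ring R] (e : R) : Submodule Rᵐᵒᵖ R :=
  Submodule.span Rᵐᵒᵖ {e}

/-- A (semiperfect) ring is basic if `1` is a sum of orthogonal primitive idempotents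
`f₁, …, fₙ` such that the right modules `fᵢR` are pairwise non-isomorphic. -/
def IsBasicRing (R : Type u) [Ring R] : Prop :=
  ∃ (n : ℕ) (f : Fin n → R), CompleteOrthogonalIdempotents f ∧
    (∀ i, IsPrimitiveIdempotent (f i)) ∧
    ∀ i j, i ≠ j → IsEmpty (rightIdeal (f i) ≃ₗ[Rᵐᵒᵖ] rightIdeal (f j))

/-! ### The semisimple module of an idempotent -/

/-- The right module `S_e = eR / rad(eR)`, where `rad` is the intersection of the maximal
submodules. -/
def topModule {R : Type u} [Ring R] (e : R) : ModuleCat.{u} Rᵐᵒᵖ :=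
  ModuleCat.of Rᵐᵒᵖ (rightIdeal e ⧸ Module.jacobson Rᵐᵒᵖ (rightIdeal e))

/-- The quotient ring `R / ⟨x⟩` by the two-sided ideal generated by `x`. -/
abbrev QuotientByTwoSided {R : Type u} [Ring R] (x : R) : Type u :=
  (TwoSidedIdeal.span {x}).ringCon.Quotient

/-- `add M`: the direct summands of finite direct sums of copies of `M`. -/
def addClosure {A : Type u} [Ring A] (M : ModuleCat.{u} A) : ObjectProperty (ModuleCat.{u} A) :=
  fun X => ∃ n : ℕ, Nonempty (Retract X (ModuleCat.of A (Fin n → M)))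

/-! ### The `m`-property -/

/-- `m(M, M')`: the supremum in `ℕ ∪ {±∞}` of the degrees `k` with `Ext^k(M, M') ≠ 0`. -/
def extSup {A : Type u} [Ring A] (M M' : ModuleCat.{u} A) : WithBot ℕ∞ :=
  sSup ((fun k : ℕ => (k : WithBot ℕ∞)) '' {k : ℕ | Nontrivial (Abelian.Ext M M' k)})

/-- `X'` is an `m`-dual of `X` with respect to the subcategory `𝒳`. -/
def IsMDual {A : Type u} [Ring A] (𝒳 : ObjectProperty (ModuleCat.{u} A))
    (X X' : ModuleCat.{u} A) : Prop :=
  𝒳 X' ∧ ∀ X'' : ModuleCat.{u} A, 𝒳 X'' → extSup X'' X' ≤ extSup X X'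

/-- The `m`-property of a subcategory `𝒳`: the function `m` is bounded above on `𝒳`, and every
nonzero object of `𝒳` has a nonzero `m`-dual with respect to `𝒳`. (The zero object satisfies the
inequalities in the definition of an `m`-dual of any `X`, and has to be left out.) -/
def HasMProperty {A : Type u} [Ring A] (𝒳 : ObjectProperty (ModuleCat.{u} A)) : Prop :=
  (∃ N : ℕ, ∀ X X' : ModuleCat.{u} A, 𝒳 X → 𝒳 X' → extSup X X' ≤ (N : WithBot ℕ∞)) ∧
    ∀ X : ModuleCat.{u} A, 𝒳 X → ¬ Limits.IsZero X →
      ∃ X' : ModuleCat.{u} A, ¬ Limits.IsZero X' ∧ IsMDual 𝒳 X X'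

/-! ### The Yoneda ring and its graded Loewy length -/

/-- The homogeneous components of the Yoneda ring `Ext^*(M, M)`. -/
abbrev YonedaComponent {A : Type u} [Ring A] (M : ModuleCat.{u} A) (k : ℕ) : Type u :=
  Abelian.Ext M M k

theorem yoneda_mk_comp {A : Type u} [Ring A] (M : ModuleCat.{u} A) {a b c : ℕ}
    (x : YonedaComponent M a) (y : YonedaComponent M b) (h : a + b = c) :
    (⟨a + b, x.comp y rfl⟩ : GradedMonoid (YonedaComponent M)) = ⟨c, x.comp y h⟩ := by
  subst h; rfl

/-- The graded ring structure on `Ext^*(M, M)` given by the Yoneda product; `x * y` is the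
composite "first `x`, then `y`". -/
instance yonedaGRing {A : Type u} [Ring A] (M : ModuleCat.{u} A) :
    DirectSum.GRing (YonedaComponent M) :=
  letI : GradedMonoid.GMul (YonedaComponent M) := ⟨fun x y => x.comp y rfl⟩
  letI : GradedMonoid.GOne (YonedaComponent M) := ⟨Abelian.Ext.mk₀ (𝟙 M)⟩
  letI : GradedMonoid.GMonoid (YonedaComponent M) :=
    { one_mul := fun ⟨k, a⟩ => (yoneda_mk_comp M (Abelian.Ext.mk₀ (𝟙 M)) a (zero_add k)).trans
        (congrArg (GradedMonoid.mk k) (Abelian.Ext.mk₀_id_comp a))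
      mul_one := fun ⟨k, a⟩ => (yoneda_mk_comp M a (Abelian.Ext.mk₀ (𝟙 M)) (add_zero k)).trans
        (congrArg (GradedMonoid.mk k) (Abelian.Ext.comp_mk₀_id a))
      mul_assoc := fun ⟨i, a⟩ ⟨j, b⟩ ⟨k, c⟩ =>
        (yoneda_mk_comp M (a.comp b rfl) c (add_assoc i j k)).trans
          (congrArg (GradedMonoid.mk (A := YonedaComponent M) (i + (j + k)))
            (show (a.comp b rfl).comp c (add_assoc i j k) = a.comp (b.comp c rfl) rfl from
              Abelian.Ext.comp_assoc a b c rfl rfl (add_assoc i j k))) }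
  { mul_zero := fun a => Abelian.Ext.comp_zero a _ _ _ _
    zero_mul := fun b => Abelian.Ext.zero_comp _ _ b _ _
    mul_add := fun a b c => Abelian.Ext.comp_add a b c _
    add_mul := fun a b c => Abelian.Ext.add_comp a b c _
    natCast := fun n => n • Abelian.Ext.mk₀ (𝟙 M)
    natCast_zero := zero_smul _ _
    natCast_succ := fun n => succ_nsmul _ n
    intCast := fun n => n • Abelian.Ext.mk₀ (𝟙 M)
    intCast_ofNat := fun n => natCast_zsmul _ n
    intCast_negSucc_ofNat := fun n => negSucc_zsmul _ n }

/-- The graded Loewy length of the graded right module `f𝒜`, for `f` an element of degree `0` of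
a graded ring `𝒜`: the length of its filtration by degrees, that is the supremum of the numbers
`k + 1` with `f𝒜_k ≠ 0`. -/
def gradedLoewyLength (𝒜 : ℕ → Type*) [∀ i, AddCommMonoid (𝒜 i)] [DirectSum.GSemiring 𝒜]
    (f : 𝒜 0) : ℕ∞ :=
  sSup {l : ℕ∞ | ∃ (k : ℕ) (y : 𝒜 k), f • y ≠ 0 ∧ l = k + 1}

open scoped DirectSum in
/-- A graded ring `𝒜` has uniformly graded Loewy length if all its indecomposable graded projective
right modules `f𝒜`, with `f` a primitive idempotent of degree `0`, have the same finite graded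
Loewy length. -/
def HasUniformlyGradedLoewyLength (𝒜 : ℕ → Type*) [∀ i, AddCommMonoid (𝒜 i)]
    [DirectSum.GSemiring 𝒜] : Prop :=
  ∃ n : ℕ, ∀ f : 𝒜 0, IsPrimitiveIdempotent f → gradedLoewyLength 𝒜 f = n

/-! ### Tensor products and `Tor` over noncommutative rings -/

section Tensor

variable (Γ : Type u) [Ring Γ]

/-- The relations `mγ ⊗ n = m ⊗ γn` in `M ⊗_ℤ N`. -/
def balancedRelations (M N : Type u) [AddCommGroup M] [Module Γᵐᵒᵖ M] [AddCommGroup N]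
    [Module Γ N] : Submodule ℤ (M ⊗[ℤ] N) :=
  Submodule.span ℤ
    {x | ∃ (m : M) (γ : Γ) (n : N), x = (op γ • m) ⊗ₜ[ℤ] n - m ⊗ₜ[ℤ] (γ • n)}

/-- The abelian group `M ⊗_Γ N` for a right module `M` and a left module `N`. -/
abbrev BalancedTensor (M N : Type u) [AddCommGroup M] [Module Γᵐᵒᵖ M] [AddCommGroup N]
    [Module Γ N] : Type u :=
  (M ⊗[ℤ] N) ⧸ balancedRelations Γ M N

variable {M M' : Type u} (N : Type u) [AddCommGroup M] [Module Γᵐᵒᵖ M] [AddCommGroup M']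
  [Module Γᵐᵒᵖ M'] [AddCommGroup N] [Module Γ N]

theorem balancedRelations_le_comap (φ : M →ₗ[Γᵐᵒᵖ] M') :
    balancedRelations Γ M N ≤
      (balancedRelations Γ M' N).comap (φ.toAddMonoidHom.toIntLinearMap.rTensor N) := by
  refine Submodule.span_le.2 ?_
  rintro _ ⟨m, γ, n, rfl⟩
  refine Submodule.subset_span ⟨φ m, γ, n, ?_⟩
  simp

/-- The map `φ ⊗_Γ N`. -/
def balancedTensorMap (φ : M →ₗ[Γᵐᵒᵖ] M') : BalancedTensor Γ M N →ₗ[ℤ] BalancedTensor Γ M' N :=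
  Submodule.mapQ _ _ (φ.toAddMonoidHom.toIntLinearMap.rTensor N)
    (balancedRelations_le_comap Γ N φ)

theorem balancedTensorMap_ext {P : Type u} [AddCommGroup P] {φ ψ : BalancedTensor Γ M N →ₗ[ℤ] P}
    (h : ∀ (m : M) (n : N), φ (Submodule.Quotient.mk (m ⊗ₜ n)) =
      ψ (Submodule.Quotient.mk (m ⊗ₜ n))) : φ = ψ :=
  Submodule.linearMap_qext _ (TensorProduct.ext' h)

end Tensor

/-- The functor `- ⊗_Γ N` from right `Γ`-modules to abelian groups. -/
def tensorFunctor (Γ : Type u) [Ring Γ] (N : Type u) [AddCommGroup N] [Module Γ N] :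
    ModuleCat.{u} Γᵐᵒᵖ ⥤ ModuleCat.{u} ℤ where
  obj M := ModuleCat.of ℤ (BalancedTensor Γ M N)
  map φ := ModuleCat.ofHom (balancedTensorMap Γ N φ.hom)
  map_id _ := ModuleCat.hom_ext (balancedTensorMap_ext Γ N fun _ _ => rfl)
  map_comp _ _ := ModuleCat.hom_ext (balancedTensorMap_ext Γ N fun _ _ => rfl)

instance tensorFunctor_additive (Γ : Type u) [Ring Γ] (N : Type u) [AddCommGroup N] [Module Γ N] :
    (tensorFunctor Γ N).Additive where
  map_add {_ _ φ ψ} := ModuleCat.hom_ext (balancedTensorMap_ext Γ N fun m n =>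
    congrArg Submodule.Quotient.mk (TensorProduct.add_tmul (φ.hom m) (ψ.hom m) n))

/-- `Tor_k^Γ(M, N)` for a right module `M` and a left module `N`: the left derived functors of
`- ⊗_Γ N`. -/
def torGroup (Γ : Type u) [Ring Γ] (M N : Type u) [AddCommGroup M] [Module Γᵐᵒᵖ M]
    [AddCommGroup N] [Module Γ N] (k : ℕ) : ModuleCat.{u} ℤ :=
  ((tensorFunctor Γ N).leftDerived k).obj (ModuleCat.of Γᵐᵒᵖ M)

/-! ### Peirce components

For an idempotent `f`, Mathlib's `IsIdempotentElem.Corner` is the ring `fRf` with unit `f`. -/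

/-- The additive subgroup `fRg` of `R`. -/
def peirceComponent {R : Type u} [Ring R] (f g : R) : AddSubgroup R :=
  ((AddMonoidHom.mulRight g).comp (AddMonoidHom.mulLeft f)).range

theorem mem_peirceComponent_iff {R : Type u} [Ring R] {f g x : R} :
    x ∈ peirceComponent f g ↔ ∃ r : R, f * r * g = x := Iff.rfl

/-- `fRg` is a left `fRf`-module. -/
instance peirceLeftModule {R : Type u} [Ring R] {f : R} (hf : IsIdempotentElem f) (g : R) :
    Module hf.Corner (peirceComponent f g) where
  smul γ x := ⟨γ.1 * x.1, by
    obtain ⟨_, a, rfl⟩ := γ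
    obtain ⟨_, b, rfl⟩ := x
    exact ⟨a * f * (f * b), by simp [mul_assoc]⟩⟩
  one_smul x := Subtype.ext <| by
    obtain ⟨_, b, rfl⟩ := x
    change f * (f * b * g) = f * b * g
    rw [← mul_assoc, ← mul_assoc, hf.eq]
  mul_smul γ δ x := Subtype.ext (mul_assoc γ.1 δ.1 x.1)
  smul_zero γ := Subtype.ext (mul_zero γ.1)
  smul_add γ x y := Subtype.ext (mul_add γ.1 x.1 y.1)
  add_smul γ δ x := Subtype.ext (add_mul γ.1 δ.1 x.1)
  zero_smul x := Subtype.ext (zero_mul x.1)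

/-- `fRg` is a right `gRg`-module. -/
instance peirceRightModule {R : Type u} [Ring R] (f : R) {g : R} (hg : IsIdempotentElem g) :
    Module hg.Cornerᵐᵒᵖ (peirceComponent f g) where
  smul γ x := ⟨x.1 * γ.unop.1, by
    obtain ⟨a, ha⟩ := γ.unop.2
    obtain ⟨_, b, rfl⟩ := x
    exact ⟨b * g * (g * a), by simp [← ha, mul_assoc]⟩⟩
  one_smul x := Subtype.ext <| by
    obtain ⟨_, b, rfl⟩ := x
    change f * b * g * g = f * b * g
    rw [mul_assoc, hg.eq]
  mul_smul γ δ x := Subtype.ext (mul_assoc x.1 δ.unop.1 γ.unop.1).symm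
  smul_zero γ := Subtype.ext (zero_mul γ.unop.1)
  smul_add γ x y := Subtype.ext (add_mul x.1 y.1 γ.unop.1)
  add_smul γ δ x := Subtype.ext (mul_add x.1 γ.unop.1 δ.unop.1)
  zero_smul x := Subtype.ext (mul_zero x.1)

end

noncomputable section

/-! ### Primitive idempotents and the radical of a basic semiperfect ring. -/

section RingTheory

variable {R : Type u} [Ring R]

/-! Put `g = 1 - e`. Starting from `Z₀ = eR`, choose maps `φᵢ : Pᵢ = (gR)ⁿ → Zᵢ` whose image
contains `Zᵢg`, and let `Zᵢ₊₁ = ker φᵢ`. This gives a complex `⋯ → P₁ → P₀ → eR` whose homology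
modules `Hᵢ = Zᵢ / im φᵢ` are killed by `g`; as `R/⟨g⟩` is right artinian, they have finite length,
with all composition factors in `add S_e`. Multiplication by `g` turns the complex into a projective
resolution of `eRg` over `gRg`, and tensoring that with `gRe` recovers the `e`-part of the `Pᵢ`.
Hence the vanishing of Tor makes `Hᵢ` zero for large `i` (`surjective_coverMap_of_isZero_torGroup`).
On the other hand `H₀ ≠ 0`: since `R` is basic, `S_e` is killed by `g`, so it is not a quotient of
any `(gR)ⁿ`. Let `d` be the largest index with `H_d ≠ 0`.

Let `V` be killed by `g`, and suppose that `Ext^k(S, V) = 0` for `k > m` and every simple `S` killed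
by `g`. Since `Ext^*(Pᵢ, V) = 0`, dimension shifting along the complex reduces the vanishing of
`Ext^m(H_d, V)` to that of `Ext^{m+d}(eR, V)`, which holds unless `m = d = 0`
(`subsingleton_ext_homology`). If `X` is a simple submodule of `H_d`, then `Ext^m(X, V)` is squeezed
between `Ext^m(H_d, V)` and `Ext^{m+1}(H_d/X, V) = 0`, so it vanishes for `m > 0`. This is
`exists_isSimpleModule_forall_eq_zero`, with `X` independent of `V`.

For (1), take for `V` an `m`-dual of `X`. For (2), take `V = S_e`: uniform Loewy length says that
`Ext^*(S, S_e)` has the same top degree for all simple `S` in question. In both cases the top degree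
must be `0`. -/

theorem isUnit_one_sub_of_mem_jacobson {x : R} (hx : x ∈ Ring.jacobson R) : IsUnit (1 - x) := by
  have left_inv : ∀ r : R, r - 1 ∈ Ring.jacobson R → ∃ s, s * r = 1 := fun r hr => by
    rw [← Ideal.jacobson_bot] at hr
    obtain ⟨s, hs⟩ := Ideal.exists_mul_sub_mem_of_sub_one_mem_jacobson r hr
    exact ⟨s, sub_eq_zero.1 ((Submodule.mem_bot R).1 hs)⟩
  obtain ⟨s, hs⟩ := left_inv (1 - x) (by simpa using neg_mem hx)
  -- The left inverse `s` is again congruent to `1` modulo the radical, so it has a left inverse too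
  -- and is a two-sided inverse.
  obtain ⟨t, ht⟩ := left_inv s (by
    have : s - 1 = s * x := by
      rw [mul_sub, mul_one, sub_eq_iff_eq_add] at hs
      exact sub_eq_iff_eq_add'.2 hs
    exact this ▸ Ideal.mul_mem_left _ s hx)
  have : t = 1 - x := left_inv_eq_right_inv ht hs
  exact ⟨⟨1 - x, s, this ▸ ht, hs⟩, rfl⟩

theorem exists_mul_mul_eq_of_isSemisimpleRing {A : Type*} [Ring A] [IsSemisimpleRing A] (a : A) :
    ∃ c, a * c * a = a := by
  obtain ⟨p, hp, hs⟩ := IsSemisimpleRing.ideal_eq_span_idempotent (Ideal.span {a})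
  obtain ⟨c, hc⟩ := Ideal.mem_span_singleton'.1 (hs ▸ Ideal.mem_span_singleton_self p)
  obtain ⟨d, hd⟩ := Ideal.mem_span_singleton'.1 (hs ▸ Ideal.mem_span_singleton_self a)
  exact ⟨c, by rw [mul_assoc, hc, ← hd, mul_assoc, hp.eq]⟩

/-- Idempotents modulo the radical of a semiperfect ring lift within corners. -/
theorem IsSemiperfectRing.exists_lift_corner (hR : IsSemiperfectRing R) {f w : R}
    (hf : IsIdempotentElem f) (hfw : f * w = w) (hwf : w * f = w)
    (hw : w * w - w ∈ Ring.jacobson R) :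
    ∃ h, IsIdempotentElem h ∧ f * h = h ∧ h * f = h ∧ h - w ∈ Ring.jacobson R := by
  obtain ⟨h, hh, hhw⟩ := hR.exists_lift w hw
  have key : h - h * f ∈ Ring.jacobson R := by
    have : h - h * f = (h - w) - (h - w) * f := by rw [sub_mul, hwf]; abel
    exact this ▸ sub_mem hhw (Ideal.mul_mem_right f _ hhw)
  -- The unit `t = 1 - (h - hf)` satisfies `ht = hf`, so the conjugate `t⁻¹ht` absorbs `f` on the
  -- right; multiplying it by `f` on the left then lands in `fRf` and keeps it idempotent.
  obtain ⟨t, ht⟩ := isUnit_one_sub_of_mem_jacobson key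
  have hht : h * t = h * f := by
    rw [ht, mul_sub, mul_sub, ← mul_assoc, hh.eq, mul_one, sub_sub_cancel]
  set k : R := ↑t⁻¹ * h * t with hk
  have hkk : k * k = k := by
    have : k * k = ↑t⁻¹ * h * (t * ↑t⁻¹) * h * t := by simp only [hk, mul_assoc]
    rw [this, Units.mul_inv, mul_one, mul_assoc _ h h, hh.eq]
  have hkf : k * f = k := by
    rw [hk, mul_assoc _ h, hht, mul_assoc, mul_assoc, hf.eq]
  have hkh : k - h ∈ Ring.jacobson R := by
    have h1 : ↑t * (k - h) = (h - h * f) * h - (h - h * f) := by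
      rw [mul_sub, hk, ← mul_assoc, ← mul_assoc, Units.mul_inv, one_mul, hht, ht, sub_mul, one_mul,
        sub_mul, hh.eq]
      abel
    have h2 : k - h = ↑t⁻¹ * (↑t * (k - h)) := by rw [← mul_assoc, Units.inv_mul, one_mul]
    rw [h2, h1]
    exact Ideal.mul_mem_left _ _ (sub_mem (Ideal.mul_mem_right _ _ key) key)
  refine ⟨f * k, ?_, by rw [← mul_assoc, hf.eq], by rw [mul_assoc, hkf], ?_⟩
  · change f * k * (f * k) = f * k
    rw [mul_assoc, ← mul_assoc k, hkf, hkk]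
  · have : f * k - w = f * (k - w) := by rw [mul_sub, hfw]
    rw [this, ← sub_add_sub_cancel k h w]
    exact Ideal.mul_mem_left _ _ (add_mem hkh hhw)

/-- A primitive idempotent of a semiperfect ring is local: elements of `fR` outside of the
radical generate `fR`. -/
theorem IsPrimitiveIdempotent.exists_mul_eq (hR : IsSemiperfectRing R) {f a : R}
    (hf : IsPrimitiveIdempotent f) (hfa : f * a = a) (ha : a ∉ Ring.jacobson R) :
    ∃ b, a * b = f := by
  have hff := hf.isIdempotentElem
  have := hR.isSemisimpleRing_quotient
  obtain ⟨c', hc'⟩ := exists_mul_mul_eq_of_isSemisimpleRing (Ideal.Quotient.mk (Ring.jacobson R) a)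
  obtain ⟨c, rfl⟩ := Ideal.Quotient.mk_surjective c'
  rw [← map_mul, ← map_mul, Ideal.Quotient.eq] at hc'
  -- Because `aca ≡ a` modulo the radical, `w ∈ fRf` is idempotent there. Its lift inside `fRf` is
  -- `0` or `f` by primitivity: the first forces `a` into the radical, the second makes `a` right
  -- invertible up to a unit.
  set w := a * c * f with hw
  have hww : w * w - w ∈ Ring.jacobson R := by
    have : w * w - w = (a * c * a - a) * (c * f) := by
      rw [hw, sub_mul]
      congr 1
      · calc a * c * f * (a * c * f) = a * c * (f * a) * c * f := by simp only [mul_assoc]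
          _ = _ := by rw [hfa]; simp only [mul_assoc]
      · simp only [mul_assoc]
    exact this ▸ Ideal.mul_mem_right _ _ hc'
  obtain ⟨h, hh, hfh, hhf, hhw⟩ := hR.exists_lift_corner hff
    (by rw [hw, ← mul_assoc, ← mul_assoc, hfa]) (by rw [hw, mul_assoc, hff.eq]) hww
  have hcompl : IsIdempotentElem (f - h) := by
    change (f - h) * (f - h) = _
    rw [sub_mul, mul_sub, mul_sub, hff.eq, hfh, hhf, hh.eq]; abel
  rcases hf.eq_zero_or_eq_zero h (f - h) hh hcompl (by rw [mul_sub, hhf, hh.eq, sub_self])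
    (by rw [sub_mul, hfh, hh.eq, sub_self]) (by abel) with h0 | h0
  · exfalso
    rw [h0, zero_sub, neg_mem_iff] at hhw
    apply ha
    have h1 : w * a ∈ Ring.jacobson R := Ideal.mul_mem_right _ _ hhw
    rw [hw, mul_assoc (a * c), hfa] at h1
    have := sub_mem h1 hc'
    rwa [sub_sub_cancel] at this
  · obtain rfl := sub_eq_zero.1 h0
    obtain ⟨u, hu⟩ := isUnit_one_sub_of_mem_jacobson hhw
    refine ⟨c * f * ↑u⁻¹, ?_⟩
    have h2 : f * u = w := by
      rw [hu, mul_sub, mul_sub, mul_one, hff.eq, hw, ← mul_assoc, ← mul_assoc, hfa, sub_sub_cancel]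
    rw [← mul_assoc, ← mul_assoc, ← hw, ← h2, mul_assoc, Units.mul_inv, mul_one]

theorem mem_rightIdeal_iff {e x : R} (he : IsIdempotentElem e) :
    x ∈ rightIdeal e ↔ e * x = x := by
  rw [rightIdeal, Submodule.mem_span_singleton]
  constructor
  · rintro ⟨a, rfl⟩
    rw [← op_unop a, op_smul_eq_mul, ← mul_assoc, he.eq]
  · intro h
    exact ⟨op x, h⟩

/-- Mutually inverse elements of `fRg` and `gRf` give an isomorphism `gR ≅ fR`. -/
def rightIdealEquiv {f g a b : R} (hf : IsIdempotentElem f) (hg : IsIdempotentElem g)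
    (hfa : f * a = a) (hgb : g * b = b) (hab : a * b = f) (hba : b * a = g) :
    rightIdeal g ≃ₗ[Rᵐᵒᵖ] rightIdeal f where
  toFun x := ⟨a * x, (mem_rightIdeal_iff hf).2 (by rw [← mul_assoc, hfa])⟩
  invFun x := ⟨b * x, (mem_rightIdeal_iff hg).2 (by rw [← mul_assoc, hgb])⟩
  map_add' x y := Subtype.ext (mul_add a x.1 y.1)
  map_smul' r x := Subtype.ext (mul_assoc a x.1 r.unop).symm
  left_inv x := Subtype.ext (by
    change b * (a * x.1) = x.1
    rw [← mul_assoc, hba, (mem_rightIdeal_iff hg).1 x.2])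
  right_inv x := Subtype.ext (by
    change a * (b * x.1) = x.1
    rw [← mul_assoc, hab, (mem_rightIdeal_iff hf).1 x.2])

/-- A right inverse `b ∈ gRf` of `a` makes `ba` an idempotent of `gRg`. It is nonzero because `a =
a(ba)`, so it equals `g` by primitivity. -/
theorem IsPrimitiveIdempotent.exists_inverse (hR : IsSemiperfectRing R) {f g a : R}
    (hf : IsPrimitiveIdempotent f) (hg : IsPrimitiveIdempotent g) (hfa : f * a = a)
    (hag : a * g = a) (ha : a ∉ Ring.jacobson R) :
    ∃ b, g * b = b ∧ a * b = f ∧ b * a = g := by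
  obtain ⟨b', hb'⟩ := hf.exists_mul_eq hR hfa ha
  have hgg := hg.isIdempotentElem
  set b := g * b' * f with hb
  have hgb : g * b = b := by rw [hb, ← mul_assoc, ← mul_assoc, hgg.eq]
  have hbf : b * f = b := by rw [hb, mul_assoc, hf.isIdempotentElem.eq]
  have hab : a * b = f := by
    rw [hb, ← mul_assoc, ← mul_assoc, hag, hb', hf.isIdempotentElem.eq]
  have hid : IsIdempotentElem (b * a) := by
    change b * a * (b * a) = b * a
    rw [mul_assoc, ← mul_assoc a, hab, hfa]
  have hgba : g * (b * a) = b * a := by rw [← mul_assoc, hgb]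
  have hbag : b * a * g = b * a := by rw [mul_assoc, hag]
  refine ⟨b, hgb, hab, ?_⟩
  have hcompl : IsIdempotentElem (g - b * a) := by
    change (g - b * a) * (g - b * a) = _
    rw [sub_mul, mul_sub, mul_sub, hgg.eq, hgba, hbag, hid.eq]; abel
  rcases hg.eq_zero_or_eq_zero (b * a) (g - b * a) hid hcompl
    (by rw [mul_sub, hbag, hid.eq, sub_self]) (by rw [sub_mul, hgba, hid.eq, sub_self])
    (by abel) with h0 | h0
  · exfalso
    apply ha
    have : a = a * (b * a) := by rw [← mul_assoc, hab, hfa]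
    rw [this, h0, mul_zero]
    exact zero_mem _
  · exact (sub_eq_zero.1 h0).symm

/-- Modulo its radical a basic ring is a product of division rings, hence reduced. This is checked
on the Peirce components `fᵢxfⱼ`. -/
theorem IsBasicRing.mem_jacobson_of_mul_self_mem (hR : IsSemiperfectRing R) (hb : IsBasicRing R)
    {x : R} (hx : x * x ∈ Ring.jacobson R) : x ∈ Ring.jacobson R := by
  obtain ⟨n, f, hf, hprim, hne⟩ := hb
  have hff := fun i => (hprim i).isIdempotentElem
  -- An off-diagonal entry outside the radical would be invertible and give `fⱼR ≅ fᵢR`.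
  have off : ∀ i j, i ≠ j → ∀ y, f i * y * f j ∈ Ring.jacobson R := fun i j hij y => by
    by_contra hn
    have h1 : f i * (f i * y * f j) = f i * y * f j := by rw [← mul_assoc, ← mul_assoc, (hff i).eq]
    obtain ⟨b, hgb, hab, hba⟩ := (hprim i).exists_inverse hR (hprim j) h1
      (by rw [mul_assoc, (hff j).eq]) hn
    exact (hne j i hij.symm).false (rightIdealEquiv (hff i) (hff j) h1 hgb hab hba)
  have diag : ∀ i, f i * x * f i ∈ Ring.jacobson R := fun i => by
    by_contra hn
    have h1 : f i * (f i * x * f i) = f i * x * f i := by rw [← mul_assoc, ← mul_assoc, (hff i).eq]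
    have h2 : f i * x * f i * f i = f i * x * f i := by rw [mul_assoc, (hff i).eq]
    obtain ⟨b, hgb, hab, hba⟩ := (hprim i).exists_inverse hR (hprim i) h1 h2 hn
    -- Modulo off-diagonal terms, `a²` is the `i`-th diagonal entry of `x²`, so it lies in the
    -- radical, and so does `a = a²b`.
    set a := f i * x * f i with ha
    have haa : a * a ∈ Ring.jacobson R := by
      have h3 : f i * (x * x) * f i ∈ Ring.jacobson R :=
        Ideal.mul_mem_right _ _ (Ideal.mul_mem_left _ _ hx)
      have h4 : f i * (x * x) * f i = ∑ j, f i * x * f j * x * f i := by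
        simp_rw [← Finset.sum_mul, ← Finset.mul_sum]
        rw [hf.complete, mul_one, ← mul_assoc]
      rw [h4, ← Finset.add_sum_erase _ _ (Finset.mem_univ i)] at h3
      have h5 : ∑ j ∈ Finset.univ.erase i, f i * x * f j * x * f i ∈ Ring.jacobson R :=
        sum_mem fun j hj => Ideal.mul_mem_right _ _
          (Ideal.mul_mem_right _ _ (off i j (Finset.ne_of_mem_erase hj).symm x))
      have h6 := (Submodule.add_mem_iff_left _ h5).1 h3
      have h7 : a * a = f i * x * f i * x * f i := by
        rw [ha, ← mul_assoc, ← mul_assoc, mul_assoc (f i * x), (hff i).eq]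
      exact h7 ▸ h6
    apply hn
    have : a = a * a * b := by rw [mul_assoc, hab, h2]
    rw [this]
    exact Ideal.mul_mem_right _ _ haa
  have hsum : x = ∑ i, ∑ j, f i * x * f j := by
    simp_rw [← Finset.mul_sum, ← Finset.sum_mul]
    rw [hf.complete, one_mul, mul_one]
  rw [hsum]
  refine sum_mem fun i _ => sum_mem fun j _ => ?_
  by_cases h : i = j
  · exact h ▸ diag i
  · exact off i j h x

theorem IsBasicRing.mul_mul_one_sub_mem_jacobson (hR : IsSemiperfectRing R) (hb : IsBasicRing R)
    {e : R} (he : IsIdempotentElem e) (x : R) : e * x * (1 - e) ∈ Ring.jacobson R := by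
  refine hb.mem_jacobson_of_mul_self_mem hR ?_
  have : e * x * (1 - e) * (e * x * (1 - e)) = e * x * ((1 - e) * e) * x * (1 - e) := by
    simp only [mul_assoc]
  rw [this, he.one_sub_mul_self, mul_zero, zero_mul, zero_mul]
  exact zero_mem _

end RingTheory

/-! ### The semisimple module `S_e` and its simple summands. -/

section TopModule

variable {R : Type u} [Ring R]

/-- Nakayama's argument: if `mx` avoided a maximal submodule `N`, then `m = n + mxr` with `n ∈ N`,
and invertibility of `1 - xr` would put `m` into `N`. -/
theorem op_smul_mem_jacobson {M : Type*} [AddCommGroup M] [Module Rᵐᵒᵖ M] {x : R}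
    (hx : x ∈ Ring.jacobson R) (m : M) : op x • m ∈ Module.jacobson Rᵐᵒᵖ M := by
  rw [Module.jacobson, Submodule.mem_sInf]
  intro N hN
  by_contra hn
  have htop : N ⊔ Submodule.span Rᵐᵒᵖ {op x • m} = ⊤ := hN.2 _ (by
    refine lt_of_le_of_ne le_sup_left fun h => hn ?_
    rw [h]
    exact Submodule.mem_sup_right (Submodule.mem_span_singleton_self _))
  obtain ⟨n, hn', y, hy, hm⟩ := Submodule.mem_sup.1 (htop ▸ Submodule.mem_top : m ∈ _)
  obtain ⟨r, rfl⟩ := Submodule.mem_span_singleton.1 hy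
  obtain ⟨u, hu⟩ := isUnit_one_sub_of_mem_jacobson (Ideal.mul_mem_right r.unop _ hx)
  have h1 : op (u : R) • m = n := by
    rw [hu, MulOpposite.op_sub, sub_smul, op_one, one_smul, op_mul, op_unop, mul_smul]
    exact sub_eq_of_eq_add hm.symm
  have h2 : m ∈ N := by
    have : op ((u⁻¹ : Rˣ) : R) • op (u : R) • m = m := by
      rw [← mul_smul, ← op_mul, Units.mul_inv, op_one, one_smul]
    rw [← this, h1]
    exact N.smul_mem _ hn'
  exact hn (N.smul_mem _ h2)

theorem self_mem_rightIdeal (e : R) : e ∈ rightIdeal e :=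
  Submodule.mem_span_singleton_self e

/-- The map `R → S_e`, `r ↦ [er]`. -/
def toTopModule (e : R) : R →ₗ[Rᵐᵒᵖ] topModule e where
  toFun r := Submodule.Quotient.mk (op r • ⟨e, self_mem_rightIdeal e⟩)
  map_add' r s := congrArg Submodule.Quotient.mk (Subtype.ext (mul_add e r s))
  map_smul' a r := congrArg Submodule.Quotient.mk (Subtype.ext (mul_assoc e r a.unop).symm)

theorem toTopModule_surjective (e : R) : Function.Surjective (toTopModule e) := by
  intro y
  obtain ⟨⟨x, hx⟩, rfl⟩ := Submodule.Quotient.mk_surjective _ y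
  obtain ⟨r, rfl⟩ := Submodule.mem_span_singleton.1 hx
  exact ⟨r.unop, rfl⟩

theorem toTopModule_eq_zero {e x : R} (hx : e * x ∈ Ring.jacobson R) (he : IsIdempotentElem e) :
    toTopModule e x = 0 := by
  refine (Submodule.Quotient.mk_eq_zero _).2 ?_
  have : op x • (⟨e, self_mem_rightIdeal e⟩ : rightIdeal e) =
      op (e * x) • ⟨e, self_mem_rightIdeal e⟩ :=
    Subtype.ext (by
      change e * x = e * (e * x)
      rw [← mul_assoc, he.eq])
  rw [this]
  exact op_smul_mem_jacobson hx _

/-- Basicness puts `eR(1-e)` inside the radical. This makes `S_e` a module over `R/⟨1-e⟩`. -/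
theorem op_smul_topModule_eq_zero {e : R} (hR : IsSemiperfectRing R) (hb : IsBasicRing R)
    (he : IsIdempotentElem e) (m : topModule e) : op (1 - e) • m = 0 := by
  obtain ⟨x, rfl⟩ := toTopModule_surjective e m
  rw [← map_smul, op_smul_eq_mul]
  exact toTopModule_eq_zero (by
    rw [← mul_assoc]; exact hb.mul_mul_one_sub_mem_jacobson hR he x) he

instance finite_rightIdeal (e : R) : Module.Finite Rᵐᵒᵖ (rightIdeal e) :=
  Module.Finite.span_singleton Rᵐᵒᵖ e

instance finite_topModule (e : R) : Module.Finite Rᵐᵒᵖ (topModule e) :=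
  inferInstanceAs (Module.Finite Rᵐᵒᵖ (rightIdeal e ⧸ Module.jacobson Rᵐᵒᵖ (rightIdeal e)))

theorem nontrivial_topModule {e : R} (he : e ≠ 0) : Nontrivial (topModule e) := by
  have : Nontrivial (rightIdeal e) :=
    ⟨⟨e, self_mem_rightIdeal e⟩, 0, fun h => he (congrArg Subtype.val h)⟩
  exact Submodule.Quotient.nontrivial_iff.2 (Module.jacobson_lt_top Rᵐᵒᵖ (rightIdeal e)).ne

/-- `S_e` is the sum of the images of the `fᵢR`. Each image is zero or simple, since an element of
`fᵢR` outside the radical generates `fᵢR`. -/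
theorem isSemisimpleModule_topModule (hR : IsSemiperfectRing R) (hb : IsBasicRing R)
    {e : R} (he : IsIdempotentElem e) : IsSemisimpleModule Rᵐᵒᵖ (topModule e) := by
  obtain ⟨n, f, hf, hprim, -⟩ := hb
  refine isSemisimpleModule_of_isSemisimpleModule_submodule'
    (p := fun i => (rightIdeal (f i)).map (toTopModule e)) (fun i => ?_) ?_
  · set N := (rightIdeal (f i)).map (toTopModule e) with hN
    rcases subsingleton_or_nontrivial N with _ | _
    · exact { exists_isCompl := fun a => ⟨a, disjoint_iff.2 (Subsingleton.elim _ _),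
        codisjoint_iff.2 (Subsingleton.elim _ _)⟩ }
    · have : IsSimpleModule Rᵐᵒᵖ N := by
        rw [isSimpleModule_iff_toSpanSingleton_surjective]
        refine ⟨inferInstance, ?_⟩
        rintro ⟨_, a, ha, rfl⟩ hne ⟨_, b, hb, rfl⟩
        have hfi := (hprim i).isIdempotentElem
        obtain ⟨c, hc⟩ := (hprim i).exists_mul_eq hR ((mem_rightIdeal_iff hfi).1 ha)
          (fun h => hne (Subtype.ext (toTopModule_eq_zero (Ideal.mul_mem_left _ e h) he)))
        refine ⟨op (c * b), Subtype.ext ?_⟩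
        change op (c * b) • toTopModule e a = toTopModule e b
        rw [← map_smul, op_smul_eq_mul, ← mul_assoc, hc, (mem_rightIdeal_iff hfi).1 hb]
      infer_instance
  · rw [← Submodule.map_iSup, eq_top_iff, ← LinearMap.range_eq_top.2 (toTopModule_surjective e),
      LinearMap.range_eq_map]
    refine Submodule.map_mono fun x _ => ?_
    rw [← one_mul x, ← hf.complete, Finset.sum_mul]
    exact sum_mem fun i _ => Submodule.mem_iSup_of_mem i
      ((rightIdeal (f i)).smul_mem (op x) (self_mem_rightIdeal _))

/-- A simple module annihilated by `1 - e` is a direct summand of `S_e`. -/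
theorem exists_retract_topModule (hR : IsSemiperfectRing R) (hb : IsBasicRing R)
    {e : R} (he : IsIdempotentElem e) (S : ModuleCat.{u} Rᵐᵒᵖ) [IsSimpleModule Rᵐᵒᵖ S]
    (hS : ∀ s : S, op (1 - e) • s = 0) : Nonempty (Retract S (topModule e)) := by
  have := isSemisimpleModule_topModule hR hb he
  have := IsSimpleModule.nontrivial Rᵐᵒᵖ S
  obtain ⟨s, hs⟩ := exists_ne (0 : S)
  have hse : op e • s = s := by
    have := hS s
    rw [MulOpposite.op_sub, sub_smul, op_one, one_smul, sub_eq_zero] at this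
    exact this.symm
  let p : rightIdeal e →ₗ[Rᵐᵒᵖ] S :=
    { toFun := fun x => op x.1 • s
      map_add' := fun x y => by rw [← add_smul]; rfl
      map_smul' := fun r x => by
        rw [RingHom.id_apply, ← mul_smul]; rfl }
  have hp : Module.jacobson Rᵐᵒᵖ (rightIdeal e) ≤ LinearMap.ker p :=
    IsSemisimpleModule.jacobson_le_ker _ _ _ _ p
  let q : topModule e →ₗ[Rᵐᵒᵖ] S := Submodule.liftQ _ p hp
  have hq : q ≠ 0 := fun h => hs (by
    have := LinearMap.congr_fun h (Submodule.Quotient.mk ⟨e, self_mem_rightIdeal e⟩)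
    rw [← hse]
    exact this)
  obtain ⟨i, hi⟩ := IsSemisimpleModule.lifting_property q (LinearMap.surjective_of_ne_zero hq)
    LinearMap.id
  exact ⟨⟨ModuleCat.ofHom i, ModuleCat.ofHom q, ModuleCat.hom_ext hi⟩⟩

theorem addClosure_of_retract {A : Type u} [Ring A] {M X : ModuleCat.{u} A} (r : Retract X M) :
    addClosure M X :=
  ⟨1, ⟨r.trans (Retract.ofIso
    (LinearEquiv.funUnique (Fin 1) A M).symm.toModuleIso)⟩⟩

theorem smul_eq_zero_of_addClosure {A : Type u} [Ring A] {M X : ModuleCat.{u} A}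
    (hX : addClosure M X) {a : A} (ha : ∀ m : M, a • m = 0) (x : X) : a • x = 0 := by
  obtain ⟨n, ⟨r⟩⟩ := hX
  have h : r.r.hom (r.i.hom x) = x := LinearMap.congr_fun (ModuleCat.hom_ext_iff.1 r.retract) x
  rw [← h, ← map_smul]
  have : a • r.i.hom x = (0 : Fin n → M) := funext fun j => ha _
  rw [this]
  exact map_zero _

end TopModule

/-! ### Dimension shifting for Ext along a complex. -/

section ExtShift

universe w v

variable {C : Type u} [Category.{v} C] [Abelian C] [HasExt.{w} C]

namespace CategoryTheory.ShortComplex.ShortExact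

variable {S : ShortComplex C} (hS : S.ShortExact) (V : C) (n : ℕ)

include hS

theorem subsingleton_ext_X₂ (h₁ : Subsingleton (Abelian.Ext S.X₁ V n))
    (h₃ : Subsingleton (Abelian.Ext S.X₃ V n)) : Subsingleton (Abelian.Ext S.X₂ V n) :=
  subsingleton_of_forall_eq 0 fun x => by
    obtain ⟨y, rfl⟩ := Abelian.Ext.contravariant_sequence_exact₂ hS V x (Subsingleton.elim _ _)
    rw [Subsingleton.elim y 0, Abelian.Ext.comp_zero]

theorem subsingleton_ext_succ_X₃ (h₁ : Subsingleton (Abelian.Ext S.X₁ V n))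
    (h₂ : Subsingleton (Abelian.Ext S.X₂ V (n + 1))) :
    Subsingleton (Abelian.Ext S.X₃ V (n + 1)) :=
  subsingleton_of_forall_eq 0 fun x => by
    obtain ⟨y, rfl⟩ := Abelian.Ext.contravariant_sequence_exact₃ hS V x (Subsingleton.elim _ _)
      (add_comm 1 n)
    rw [Subsingleton.elim y 0, Abelian.Ext.comp_zero]

theorem subsingleton_ext_zero_X₃ (h₂ : Subsingleton (Abelian.Ext S.X₂ V 0)) :
    Subsingleton (Abelian.Ext S.X₃ V 0) :=
  have := hS.epi_g
  (Abelian.Ext.precomp_mk₀_injective_of_epi V S.g).subsingleton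

theorem subsingleton_ext_X₃ (h₁ : ∀ k, Subsingleton (Abelian.Ext S.X₁ V k))
    (h₂ : Subsingleton (Abelian.Ext S.X₂ V n)) : Subsingleton (Abelian.Ext S.X₃ V n) := by
  cases n with
  | zero => exact hS.subsingleton_ext_zero_X₃ V h₂
  | succ n => exact hS.subsingleton_ext_succ_X₃ V n (h₁ n) h₂

theorem subsingleton_ext_X₁ (h₂ : Subsingleton (Abelian.Ext S.X₂ V n))
    (h₃ : Subsingleton (Abelian.Ext S.X₃ V (n + 1))) : Subsingleton (Abelian.Ext S.X₁ V n) :=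
  subsingleton_of_forall_eq 0 fun x => by
    obtain ⟨y, rfl⟩ := Abelian.Ext.contravariant_sequence_exact₁ hS V x (add_comm 1 n)
      (Subsingleton.elim _ _)
    rw [Subsingleton.elim y 0, Abelian.Ext.comp_zero]

end CategoryTheory.ShortComplex.ShortExact

/-- Let `⋯ ⟶ P 1 ⟶ P 0 ⟶ Z 0` be a complex with cycles `Z i`, boundaries `B i` and homology
`H i`, such that `Z 0` is projective and `Ext^*(P i, V) = 0`. If `Ext^k(H i, V)` vanishes for
`k > m` and the homology vanishes above degree `d`, then `Ext^m(H d, V) = 0` unless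
`m = d = 0`. -/
theorem subsingleton_ext_homology {Z P B H : ℕ → C} {ι : ∀ i, Z (i + 1) ⟶ P i}
    {p : ∀ i, P i ⟶ B i} {j : ∀ i, B i ⟶ Z i} {q : ∀ i, Z i ⟶ H i}
    {hιp : ∀ i, ι i ≫ p i = 0} {hjq : ∀ i, j i ≫ q i = 0}
    (hP : ∀ i, (ShortComplex.mk _ _ (hιp i)).ShortExact)
    (hZ : ∀ i, (ShortComplex.mk _ _ (hjq i)).ShortExact)
    (hproj : Projective (Z 0)) {V : C} {m d : ℕ}
    (hPV : ∀ i k, Subsingleton (Abelian.Ext (P i) V k))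
    (hHV : ∀ i k, m < k → Subsingleton (Abelian.Ext (H i) V k))
    (hHd : ∀ i k, d < i → Subsingleton (Abelian.Ext (H i) V k)) (hmd : m + d ≠ 0) :
    Subsingleton (Abelian.Ext (H d) V m) := by
  have hB : ∀ i, (∀ k, Subsingleton (Abelian.Ext (Z (i + 1)) V k)) →
      ∀ k, Subsingleton (Abelian.Ext (B i) V k) := fun i h k =>
    (hP i).subsingleton_ext_X₃ V k h (hPV i k)
  -- Above `d`, `Ext^k(Z i, V)` embeds into `Ext^k(B i, V)`, which is a quotient of `Ext^{k-1}(Z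
  -- (i+1), V)`. Induction on `k` for all `i` at once ends with `Hom(B i, V) ⊆ Hom(P i, V) = 0`.
  have hZd : ∀ k i, d < i → Subsingleton (Abelian.Ext (Z i) V k) := fun k => by
    induction k with
    | zero =>
      intro i hi
      exact (hZ i).subsingleton_ext_X₂ V 0 ((hP i).subsingleton_ext_zero_X₃ V (hPV i 0))
        (hHd i 0 hi)
    | succ k ih =>
      intro i hi
      exact (hZ i).subsingleton_ext_X₂ V _
        ((hP i).subsingleton_ext_succ_X₃ V k (ih _ (by lia)) (hPV i _)) (hHd i _ hi)
  refine (hZ d).subsingleton_ext_X₃ V m (hB d fun k => hZd k _ (by lia)) ?_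
  -- `Ext^k(Z (i+1), V)` embeds into `Ext^{k+1}(B i, V)`, a quotient of `Ext^{k+1}(Z i, V)` because
  -- `k + 2 > m`. The sum `k + i = m + d` is preserved, so the descent ends at `Ext^{m+d}` of the
  -- projective `Z 0`.
  have key : ∀ i k, m + d = k + i → m ≤ k → Subsingleton (Abelian.Ext (Z i) V k) := fun i => by
    induction i with
    | zero =>
      intro k hk _
      obtain ⟨k, rfl⟩ := Nat.exists_eq_succ_of_ne_zero (by lia : k ≠ 0)
      exact Abelian.Ext.subsingleton_of_projective _ _ _
    | succ i ih =>
      intro k hk hmk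
      exact (hP i).subsingleton_ext_X₁ V k (hPV i k) ((hZ i).subsingleton_ext_X₁ V _
        (ih (k + 1) (by lia) (by lia)) (hHV i _ (by lia)))
  exact key d m rfl le_rfl

theorem CategoryTheory.Retract.subsingleton_ext {C : Type*} [Category* C] [Abelian C]
    [HasExt.{w} C] {X Y : C} (r : Retract X Y) {V : C} {k : ℕ}
    (h : Subsingleton (Abelian.Ext Y V k)) : Subsingleton (Abelian.Ext X V k) :=
  subsingleton_of_forall_eq 0 fun x => by
    rw [← Abelian.Ext.mk₀_id_comp x, ← r.retract, ← Abelian.Ext.mk₀_comp_mk₀_assoc,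
      Subsingleton.elim ((Abelian.Ext.mk₀ r.r).comp x (zero_add k)) 0, Abelian.Ext.comp_zero]

theorem CategoryTheory.Limits.IsZero.subsingleton_ext {C : Type*} [Category* C] [Abelian C]
    [HasExt.{w} C] {X : C} (hX : IsZero X) (V : C) (k : ℕ) : Subsingleton (Abelian.Ext X V k) :=
  subsingleton_of_forall_eq 0 fun x => by
    rw [← Abelian.Ext.mk₀_id_comp x, hX.eq_of_src (𝟙 X) 0, Abelian.Ext.mk₀_zero,
      Abelian.Ext.zero_comp]

end ExtShift

/-! ### Short exact sequences of modules and Ext of modules of finite length. -/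

section ExtModule

variable {A : Type u} [Ring A]

theorem LinearMap.shortExact_ker_rangeRestrict {M N : Type u} [AddCommGroup M] [Module A M]
    [AddCommGroup N] [Module A N] (f : M →ₗ[A] N) :
    (ShortComplex.mk (ModuleCat.ofHom (LinearMap.ker f).subtype)
      (ModuleCat.ofHom f.rangeRestrict) (ModuleCat.hom_ext
        (LinearMap.ext fun x => Subtype.ext x.2))).ShortExact :=
  ShortComplex.ShortExact.mk'
    (ShortComplex.Exact.moduleCat_of_range_eq_ker _ _ (by
      change LinearMap.range (LinearMap.ker f).subtype = LinearMap.ker f.rangeRestrict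
      rw [Submodule.range_subtype, LinearMap.ker_rangeRestrict]))
    ((ModuleCat.mono_iff_injective _).2 Subtype.val_injective)
    ((ModuleCat.epi_iff_surjective _).2 f.surjective_rangeRestrict)

theorem Submodule.shortExact_subtype_mkQ {M : Type u} [AddCommGroup M] [Module A M]
    (N : Submodule A M) :
    (ShortComplex.mk (ModuleCat.ofHom N.subtype)
      (ModuleCat.ofHom N.mkQ) (ModuleCat.hom_ext
        (LinearMap.ext fun x => (Submodule.Quotient.mk_eq_zero N).2 x.2))).ShortExact :=
  ShortComplex.ShortExact.mk'
    (ShortComplex.Exact.moduleCat_of_range_eq_ker _ _ (by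
      change LinearMap.range N.subtype = LinearMap.ker N.mkQ
      rw [Submodule.range_subtype, Submodule.ker_mkQ]))
    ((ModuleCat.mono_iff_injective _).2 Subtype.val_injective)
    ((ModuleCat.epi_iff_surjective _).2 N.mkQ_surjective)

/-- `Ext^k(M, V)` vanishes for modules of finite length annihilated by `a`, if it does for the
simple modules annihilated by `a`. -/
theorem IsFiniteLength.subsingleton_ext {a : A} {V : ModuleCat.{u} A} {k : ℕ}
    (hV : ∀ S : ModuleCat.{u} A, IsSimpleModule A S → (∀ s : S, a • s = 0) →
      Subsingleton (Abelian.Ext S V k))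
    {M : Type u} [AddCommGroup M] [Module A M] (hM : IsFiniteLength A M)
    (ha : ∀ x : M, a • x = 0) : Subsingleton (Abelian.Ext (ModuleCat.of A M) V k) := by
  induction hM with
  | of_subsingleton =>
    exact (ModuleCat.isZero_of_subsingleton _).subsingleton_ext V k
  | of_simple_quotient h ih =>
    rename_i M _ _ N hs
    refine N.shortExact_subtype_mkQ.subsingleton_ext_X₂ V k (ih fun x => Subtype.ext (ha x))
      (hV _ hs ?_)
    intro s
    obtain ⟨x, rfl⟩ := Submodule.Quotient.mk_surjective _ s
    exact (Submodule.Quotient.mk_smul N a x).symm.trans (by rw [ha]; rfl)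

end ExtModule

/-! ### Projective resolutions from exact sequences, and derived functors. -/

section ResolutionOfSequence

universe v

variable {C : Type u} [Category.{v} C] [Abelian C] {N : C} {X : ℕ → C}
  {d : ∀ i, X (i + 1) ⟶ X i} {π : X 0 ⟶ N}

/-- An exact sequence `⋯ ⟶ X 1 ⟶ X 0 ⟶ N ⟶ 0` with projective `X i` as a projective
resolution. -/
def CategoryTheory.ProjectiveResolution.ofSequence [∀ i, Projective (X i)]
    (hd : ∀ i, d (i + 1) ≫ d i = 0) (hπ : d 0 ≫ π = 0)
    (hex : ∀ i, (ShortComplex.mk _ _ (hd i)).Exact) (hex₀ : (ShortComplex.mk _ _ hπ).Exact)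
    [Epi π] : ProjectiveResolution N where
  complex := ChainComplex.of X d hd
  projective i := inferInstanceAs (Projective (X i))
  π := (ChainComplex.toSingle₀Equiv _ _).symm ⟨π, by
    rw [show (ChainComplex.of X d hd).d 1 0 = d 0 from ChainComplex.of_d X d 0, hπ]⟩
  quasiIso := ⟨fun i => by
    cases i with
    | zero =>
      rw [ChainComplex.quasiIsoAt₀_iff, ShortComplex.quasiIso_iff_of_zeros']
      · refine (ShortComplex.exact_and_epi_g_iff_of_iso ?_).2 ⟨hex₀, inferInstanceAs (Epi π)⟩
        exact ShortComplex.isoMk (Iso.refl _) (Iso.refl _) (Iso.refl _)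
          (by
            change 𝟙 _ ≫ d 0 = (ChainComplex.of X d hd).d 1 0 ≫ 𝟙 _
            rw [show (ChainComplex.of X d hd).d 1 0 = d 0 from ChainComplex.of_d X d 0,
              Category.id_comp, Category.comp_id])
          ((Category.id_comp π).trans ((Category.comp_id _).trans
            (ChainComplex.toSingle₀Equiv_symm_apply_f_zero
              (C := ChainComplex.of X d hd) π _)).symm)
      all_goals rfl
    | succ i =>
      rw [quasiIsoAt_iff_exactAt']
      · rw [HomologicalComplex.exactAt_iff' _ (i + 1 + 1) (i + 1) i (by simp) (by simp)]
        refine ShortComplex.exact_of_iso ?_ (hex i)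
        exact ShortComplex.isoMk (Iso.refl _) (Iso.refl _) (Iso.refl _)
          (by
            change 𝟙 _ ≫ (ChainComplex.of X d hd).d (i + 1 + 1) (i + 1) = d (i + 1) ≫ 𝟙 _
            rw [show (ChainComplex.of X d hd).d (i + 1 + 1) (i + 1) = d (i + 1) from
              ChainComplex.of_d X d (i + 1)]
            exact (Category.id_comp _).trans (Category.comp_id _).symm)
          (by
            change 𝟙 _ ≫ (ChainComplex.of X d hd).d (i + 1) i = d i ≫ 𝟙 _
            rw [show (ChainComplex.of X d hd).d (i + 1) i = d i from ChainComplex.of_d X d i]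
            exact (Category.id_comp _).trans (Category.comp_id _).symm)
      · apply ChainComplex.exactAt_succ_single_obj⟩

/-- The sequence is a projective resolution of `N`, so the homology of its image under `F` at the
term with index `i + 1` is `(F.leftDerived (i + 1)).obj N`. -/
theorem CategoryTheory.exact_map_of_isZero_leftDerived [HasProjectiveResolutions C]
    [∀ i, Projective (X i)]
    (hd : ∀ i, d (i + 1) ≫ d i = 0) (hπ : d 0 ≫ π = 0)
    (hex : ∀ i, (ShortComplex.mk _ _ (hd i)).Exact) (hex₀ : (ShortComplex.mk _ _ hπ).Exact)
    [Epi π] {D : Type*} [Category* D] [Abelian D] (F : C ⥤ D) [F.Additive] (i : ℕ)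
    (hF : Limits.IsZero ((F.leftDerived (i + 1)).obj N)) :
    (ShortComplex.mk (F.map (d (i + 1))) (F.map (d i))
      (by rw [← F.map_comp, hd, F.map_zero])).Exact := by
  have h := hF.of_iso
    ((ProjectiveResolution.ofSequence hd hπ hex hex₀).isoLeftDerivedObj F (i + 1)).symm
  have h' := (HomologicalComplex.exactAt_iff_isZero_homology _ _).2 h
  rw [HomologicalComplex.exactAt_iff' _ (i + 1 + 1) (i + 1) i (by simp) (by simp)] at h'
  refine ShortComplex.exact_of_iso ?_ h'
  have hofd : ∀ j, (ChainComplex.of X d hd).d (j + 1) j = d j := fun j => ChainComplex.of_d X d j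
  exact ShortComplex.isoMk (Iso.refl _) (Iso.refl _) (Iso.refl _)
    (by
      change 𝟙 _ ≫ F.map (d (i + 1)) =
        F.map ((ChainComplex.of X d hd).d (i + 1 + 1) (i + 1)) ≫ 𝟙 _
      rw [hofd]
      exact (Category.id_comp _).trans (Category.comp_id _).symm)
    (by
      change 𝟙 _ ≫ F.map (d i) = F.map ((ChainComplex.of X d hd).d (i + 1) i) ≫ 𝟙 _
      rw [hofd]
      exact (Category.id_comp _).trans (Category.comp_id _).symm)

end ResolutionOfSequence

/-! ### The functor `M ↦ Mg` to modules over the corner `gRg`. -/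

section CornerModule

variable {R : Type u} [Ring R]

/-- The additive subgroup `Mg` of a right module `M`. -/
def cornerSubgroup (M : Type*) [AddCommGroup M] [Module Rᵐᵒᵖ M] (g : R) : AddSubgroup M :=
  (DistribSMul.toAddMonoidHom M (op g)).range

variable {M N : Type*} [AddCommGroup M] [Module Rᵐᵒᵖ M] [AddCommGroup N] [Module Rᵐᵒᵖ N]
  {g : R}

theorem mem_cornerSubgroup_iff (hg : IsIdempotentElem g) {m : M} :
    m ∈ cornerSubgroup M g ↔ op g • m = m := by
  constructor
  · rintro ⟨m, rfl⟩
    change op g • op g • m = op g • m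
    rw [← mul_smul, ← op_mul, hg.eq]
  · intro h
    exact ⟨m, h⟩

theorem op_smul_mem_cornerSubgroup (g : R) (m : M) : op g • m ∈ cornerSubgroup M g :=
  ⟨m, rfl⟩

/-- `Mg` is a right `gRg`-module. -/
instance cornerModule (hg : IsIdempotentElem g) : Module hg.Cornerᵐᵒᵖ (cornerSubgroup M g) where
  smul γ m := ⟨op γ.unop.1 • m.1, (mem_cornerSubgroup_iff hg).2 (by
    rw [← mul_smul, ← op_mul, ((Subsemigroup.mem_corner_iff hg).1 γ.unop.2).2])⟩
  one_smul m := Subtype.ext ((mem_cornerSubgroup_iff hg).1 m.2)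
  mul_smul γ δ m := Subtype.ext (by
    change op (δ.unop.1 * γ.unop.1) • m.1 = op γ.unop.1 • op δ.unop.1 • m.1
    rw [op_mul, mul_smul])
  smul_zero γ := Subtype.ext (smul_zero _)
  smul_add γ m m' := Subtype.ext (smul_add _ m.1 m'.1)
  add_smul γ δ m := Subtype.ext (by
    change op (γ.unop.1 + δ.unop.1) • m.1 = _
    rw [MulOpposite.op_add, add_smul]; rfl)
  zero_smul m := Subtype.ext (zero_smul Rᵐᵒᵖ m.1)

theorem coe_cornerModule_smul (hg : IsIdempotentElem g) (γ : hg.Cornerᵐᵒᵖ)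
    (m : cornerSubgroup M g) : ((γ • m : cornerSubgroup M g) : M) = op γ.unop.1 • m.1 := rfl

/-- The map `Mg → Ng` induced by a homomorphism `M → N`. -/
def cornerMap (hg : IsIdempotentElem g) (φ : M →ₗ[Rᵐᵒᵖ] N) :
    cornerSubgroup M g →ₗ[hg.Cornerᵐᵒᵖ] cornerSubgroup N g where
  toFun m := ⟨φ m.1, (mem_cornerSubgroup_iff hg).2 (by
    rw [← map_smul, (mem_cornerSubgroup_iff hg).1 m.2])⟩
  map_add' m m' := Subtype.ext (map_add φ m.1 m'.1)
  map_smul' γ m := Subtype.ext (map_smul φ (op γ.unop.1) m.1)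

theorem coe_cornerMap (hg : IsIdempotentElem g) (φ : M →ₗ[Rᵐᵒᵖ] N) (m : cornerSubgroup M g) :
    (cornerMap hg φ m : N) = φ m := rfl

/-- `(eR)g = eRg`. -/
def cornerRightIdealEquiv {e : R} (he : IsIdempotentElem e) (hg : IsIdempotentElem g) :
    cornerSubgroup (rightIdeal e) g ≃ₗ[hg.Cornerᵐᵒᵖ] peirceComponent e g where
  toFun m := ⟨m.1.1, by
    refine mem_peirceComponent_iff.2 ⟨m.1.1, ?_⟩
    rw [(mem_rightIdeal_iff he).1 m.1.2]
    exact congrArg Subtype.val ((mem_cornerSubgroup_iff hg).1 m.2)⟩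
  invFun x := ⟨⟨x.1, by
    obtain ⟨_, r, rfl⟩ := x
    refine (mem_rightIdeal_iff he).2 ?_
    change e * (e * r * g) = e * r * g
    rw [← mul_assoc, ← mul_assoc, he.eq]⟩, (mem_cornerSubgroup_iff hg).2 (Subtype.ext (by
      obtain ⟨_, r, rfl⟩ := x
      change e * r * g * g = e * r * g
      rw [mul_assoc, hg.eq]))⟩
  map_add' _ _ := rfl
  map_smul' _ _ := rfl
  left_inv _ := rfl
  right_inv _ := rfl

/-- `(gR)ⁿg = (gRg)ⁿ`. -/
def cornerPiEquiv (hg : IsIdempotentElem g) (n : ℕ) :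
    cornerSubgroup (Fin n → rightIdeal g) g ≃ₗ[hg.Cornerᵐᵒᵖ] (Fin n → hg.Corner) where
  toFun m i := ⟨(m.1 i).1, (Subsemigroup.mem_corner_iff hg).2 ⟨(mem_rightIdeal_iff hg).1 (m.1 i).2,
    congrArg Subtype.val (congrFun ((mem_cornerSubgroup_iff hg).1 m.2) i)⟩⟩
  invFun x := ⟨fun i => ⟨(x i).1, (mem_rightIdeal_iff hg).2
      ((Subsemigroup.mem_corner_iff hg).1 (x i).2).1⟩,
    (mem_cornerSubgroup_iff hg).2 (funext fun i => Subtype.ext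
      ((Subsemigroup.mem_corner_iff hg).1 (x i).2).2)⟩
  map_add' _ _ := rfl
  map_smul' _ _ := rfl
  left_inv _ := rfl
  right_inv _ := rfl

theorem free_mulOpposite_self (A : Type*) [Ring A] : Module.Free Aᵐᵒᵖ A :=
  have e : Aᵐᵒᵖ ≃ₗ[Aᵐᵒᵖ] A :=
    { toFun := unop
      map_add' := fun _ _ => rfl
      map_smul' := fun _ _ => rfl
      invFun := op
      left_inv := fun _ => rfl
      right_inv := fun _ => rfl }
  Module.Free.of_equiv e

theorem projective_cornerSubgroup_pi (hg : IsIdempotentElem g) (n : ℕ) :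
    Module.Projective hg.Cornerᵐᵒᵖ (cornerSubgroup (Fin n → rightIdeal g) g) :=
  have := free_mulOpposite_self hg.Corner
  have : Module.Free hg.Cornerᵐᵒᵖ (Fin n → hg.Corner) := inferInstance
  Module.Projective.of_equiv (cornerPiEquiv hg n).symm

end CornerModule

/-! ### The identification `(gR)ⁿg ⊗ gRh ≅ (gR)ⁿh`. -/

section TensorCorner

variable {R : Type u} [Ring R] {M N : Type u} [AddCommGroup M] [Module Rᵐᵒᵖ M] [AddCommGroup N]
  [Module Rᵐᵒᵖ N] {g : R} (hg : IsIdempotentElem g) (h : R)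

/-- The map `Mg ⊗_{gRg} gRh → M`, `m ⊗ y ↦ my`. -/
def cornerAction (M : Type u) [AddCommGroup M] [Module Rᵐᵒᵖ M] :
    BalancedTensor hg.Corner (cornerSubgroup M g) (peirceComponent g h) →ₗ[ℤ] M :=
  Submodule.liftQ _
    (TensorProduct.lift (LinearMap.mk₂ ℤ (fun m y => op (y : R) • (m : M))
      (fun m m' y => smul_add _ _ _)
      (fun c m y => smul_comm _ c (m : M))
      (fun m y y' => by
        change op (y.1 + y'.1) • m.1 = _
        rw [MulOpposite.op_add, add_smul])
      (fun c m y => by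
        change op (c • y.1) • m.1 = _
        rw [op_smul, smul_assoc])))
    (by
      refine Submodule.span_le.2 ?_
      rintro _ ⟨m, γ, y, rfl⟩
      change TensorProduct.lift _ _ = 0
      rw [map_sub, TensorProduct.lift.tmul, TensorProduct.lift.tmul, sub_eq_zero]
      change op y.1 • op γ.1 • m.1 = op (γ.1 * y.1) • m.1
      rw [op_mul, mul_smul])

theorem cornerAction_mk (m : cornerSubgroup M g) (y : peirceComponent g h) :
    cornerAction hg h M (Submodule.Quotient.mk (m ⊗ₜ y)) = op (y : R) • (m : M) := rfl

theorem cornerAction_map (φ : M →ₗ[Rᵐᵒᵖ] N)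
    (t : BalancedTensor hg.Corner (cornerSubgroup M g) (peirceComponent g h)) :
    cornerAction hg h N (balancedTensorMap hg.Corner (peirceComponent g h) (cornerMap hg φ) t) =
      φ (cornerAction hg h M t) :=
  LinearMap.congr_fun (balancedTensorMap_ext hg.Corner (peirceComponent g h)
    (φ := cornerAction hg h N ∘ₗ balancedTensorMap hg.Corner (peirceComponent g h) (cornerMap hg φ))
    (ψ := φ.toAddMonoidHom.toIntLinearMap ∘ₗ cornerAction hg h M)
    (fun m y => (map_smul φ (op (y : R)) (m : M)).symm)) t

/-- The element `g` in the `i`-th coordinate of `(gR)ⁿ`. -/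
def cornerSingle (n : ℕ) (i : Fin n) : cornerSubgroup (Fin n → rightIdeal g) g :=
  ⟨Pi.single i ⟨g, self_mem_rightIdeal g⟩, (mem_cornerSubgroup_iff hg).2 (by
    rw [← Pi.single_smul]
    congr 1
    exact Subtype.ext hg.eq)⟩

theorem exists_cornerAction_eq (n : ℕ) {x : Fin n → rightIdeal g} (hx : op h • x = x) :
    ∃ t, cornerAction hg h (Fin n → rightIdeal g) t = x := by
  have hxi : ∀ i, (x i).1 ∈ peirceComponent g h := fun i => by
    refine mem_peirceComponent_iff.2 ⟨(x i).1, ?_⟩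
    rw [(mem_rightIdeal_iff hg).1 (x i).2]
    exact congrArg Subtype.val (congrFun hx i)
  refine ⟨∑ i, Submodule.Quotient.mk (cornerSingle hg n i ⊗ₜ ⟨(x i).1, hxi i⟩), ?_⟩
  rw [map_sum]
  simp only [cornerAction_mk, cornerSingle, ← Pi.single_smul]
  conv_rhs => rw [← Finset.univ_sum_single x]
  refine Finset.sum_congr rfl fun i _ => congrArg _ (Subtype.ext ?_)
  exact (mem_rightIdeal_iff hg).1 (x i).2

/-- The map `gR → gRh`, `x ↦ xh`. -/
def mulRightPeirce : rightIdeal g →ₗ[ℤ] peirceComponent g h :=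
  (AddMonoidHom.mk' (fun x : rightIdeal g => (⟨x.1 * h, mem_peirceComponent_iff.2 ⟨x.1, by
    rw [(mem_rightIdeal_iff hg).1 x.2]⟩⟩ : peirceComponent g h))
    (fun x y => Subtype.ext (add_mul x.1 y.1 h))).toIntLinearMap

/-- A left inverse is `x ↦ ∑ᵢ εᵢ ⊗ xᵢh`, where `εᵢ` has the entry `g` in place `i`. On `my` it
returns `m ⊗ y`, because `m = ∑ εᵢγᵢ` with `γᵢ ∈ gRg` and the `γᵢ` move across the tensor sign. -/
theorem cornerAction_injective (hh : IsIdempotentElem h) (n : ℕ) :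
    Function.Injective (cornerAction hg h (Fin n → rightIdeal g)) := by
  let β : (Fin n → rightIdeal g) →ₗ[ℤ]
      BalancedTensor hg.Corner (cornerSubgroup (Fin n → rightIdeal g) g) (peirceComponent g h) :=
    ∑ i, (balancedRelations hg.Corner _ _).mkQ ∘ₗ
      TensorProduct.mk ℤ _ _ (cornerSingle hg n i) ∘ₗ mulRightPeirce hg h ∘ₗ LinearMap.proj i
  have hβ : β ∘ₗ cornerAction hg h (Fin n → rightIdeal g) = LinearMap.id := by
    refine balancedTensorMap_ext _ _ fun m y => ?_
    have hγ : ∀ i, (m.1 i).1 ∈ NonUnitalRing.corner g := fun i =>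
      (Subsemigroup.mem_corner_iff hg).2 ⟨(mem_rightIdeal_iff hg).1 (m.1 i).2,
        congrArg Subtype.val (congrFun ((mem_cornerSubgroup_iff hg).1 m.2) i)⟩
    let γ : Fin n → hg.Corner := fun i => ⟨(m.1 i).1, hγ i⟩
    have hm : m = ∑ i, op (γ i) • cornerSingle hg n i := by
      refine Subtype.ext ?_
      rw [AddSubgroup.val_finsetSum, ← Finset.univ_sum_single m.1]
      refine Finset.sum_congr rfl fun i _ => ?_
      rw [coe_cornerModule_smul, cornerSingle, ← Pi.single_smul]
      congr 1
      exact Subtype.ext ((mem_rightIdeal_iff hg).1 (m.1 i).2).symm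
    have hyh : (y : R) * h = y := by
      obtain ⟨_, r, rfl⟩ := y
      change g * r * h * h = g * r * h
      rw [mul_assoc, hh.eq]
    have hy : ∀ i, mulRightPeirce hg h ((op (y : R) • m.1) i) = γ i • y := fun i =>
      Subtype.ext (by
        change (m.1 i).1 * y.1 * h = (m.1 i).1 * y.1
        rw [mul_assoc, hyh])
    have hβm : β (op (y : R) • m.1) = ∑ i, (balancedRelations hg.Corner _ _).mkQ
        (cornerSingle hg n i ⊗ₜ (γ i • y)) := by
      rw [LinearMap.sum_apply]
      refine Finset.sum_congr rfl fun i _ => ?_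
      rw [← hy]
      rfl
    change β (op (y : R) • m.1) = (balancedRelations hg.Corner _ _).mkQ (m ⊗ₜ y)
    rw [hβm]
    conv_rhs => rw [hm, TensorProduct.sum_tmul, map_sum]
    refine Finset.sum_congr rfl fun i _ => ((Submodule.Quotient.eq _).2 ?_).symm
    exact Submodule.subset_span ⟨_, _, _, rfl⟩
  intro s t hst
  have := congrArg β hst
  rwa [← LinearMap.comp_apply, ← LinearMap.comp_apply, hβ] at this

end TensorCorner

/-! ### The complex of modules `(gR)ⁿ` and its relation to Tor. -/

section Syzygy

variable {R : Type u} [Ring R]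

/-- The submodule generated by `Mg` has finitely many generators of the form `xᵢg`, and left
multiplication by `xᵢ` maps `gR` to `M` with `g ↦ xᵢg`. -/
theorem exists_map_pi_rightIdeal (M : Type u) [AddCommGroup M] [Module Rᵐᵒᵖ M]
    [IsNoetherian Rᵐᵒᵖ M] (g : R) :
    ∃ (n : ℕ) (φ : (Fin n → rightIdeal g) →ₗ[Rᵐᵒᵖ] M), ∀ x : M, op g • x ∈ LinearMap.range φ := by
  obtain ⟨s, hs, hspan⟩ := (Submodule.fg_span_iff_fg_span_finset_subset (R := Rᵐᵒᵖ)
    (Set.range fun x : M => op g • x)).1 (IsNoetherian.noetherian _)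
  obtain ⟨n, y, hy⟩ : ∃ (n : ℕ) (y : Fin n → M), Set.range y = s :=
    ⟨s.card, fun i => s.equivFin.symm i, by
      rw [Set.range_comp' Subtype.val, s.equivFin.symm.surjective.range_eq]
      simp⟩
  choose x hx using fun i => hs (hy ▸ Set.mem_range_self i)
  let ψ : ∀ i, rightIdeal g →ₗ[Rᵐᵒᵖ] M := fun i =>
    { toFun := fun r => op r.1 • x i
      map_add' := fun r r' => by rw [← add_smul]; rfl
      map_smul' := fun a r => by rw [RingHom.id_apply, ← mul_smul]; rfl }
  let φ : (Fin n → rightIdeal g) →ₗ[Rᵐᵒᵖ] M := ∑ i, ψ i ∘ₗ LinearMap.proj i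
  refine ⟨n, φ, fun z => ?_⟩
  suffices Submodule.span Rᵐᵒᵖ (s : Set M) ≤ LinearMap.range φ from
    this (hspan ▸ Submodule.subset_span ⟨z, rfl⟩)
  rw [← hy, Submodule.span_le]
  rintro _ ⟨i, rfl⟩
  refine ⟨Pi.single i ⟨g, self_mem_rightIdeal g⟩, ?_⟩
  rw [LinearMap.sum_apply, Finset.sum_eq_single i]
  · change ψ i (Pi.single (M := fun _ => rightIdeal g) i ⟨g, self_mem_rightIdeal g⟩ i) = y i
    rw [Pi.single_eq_same]
    exact hx i
  · intro j _ hj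
    change ψ j (Pi.single (M := fun _ => rightIdeal g) i ⟨g, self_mem_rightIdeal g⟩ j) = 0
    rw [Pi.single_eq_of_ne hj, map_zero]
  · exact fun h => absurd (Finset.mem_univ i) h

/-- Noetherian modules. -/
abbrev NoetherianModule (A : Type u) [Ring A] : Type (u + 1) :=
  {M : ModuleCat.{u} A // IsNoetherian A M}

/-- The rank `n` of a chosen map `(gR)ⁿ → M` whose image contains `Mg`. -/
def coverRank (g : R) (M : NoetherianModule Rᵐᵒᵖ) : ℕ :=
  have := M.2
  (exists_map_pi_rightIdeal M.1 g).choose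

/-- A chosen map `(gR)ⁿ → M` whose image contains `Mg`. -/
def coverMap (g : R) (M : NoetherianModule Rᵐᵒᵖ) :
    (Fin (coverRank g M) → rightIdeal g) →ₗ[Rᵐᵒᵖ] M.1 :=
  have := M.2
  (exists_map_pi_rightIdeal M.1 g).choose_spec.choose

theorem op_smul_mem_range_coverMap (g : R) (M : NoetherianModule Rᵐᵒᵖ) (x : M.1) :
    op g • x ∈ LinearMap.range (coverMap g M) :=
  have := M.2
  (exists_map_pi_rightIdeal M.1 g).choose_spec.choose_spec x

variable [IsNoetherianRing Rᵐᵒᵖ]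

/-- The iterated kernels of the maps `(gR)ⁿ → M` whose image contains `Mg`. -/
def syzygy (g : R) (M : NoetherianModule Rᵐᵒᵖ) : ℕ → NoetherianModule Rᵐᵒᵖ
  | 0 => M
  | i + 1 => ⟨ModuleCat.of Rᵐᵒᵖ (LinearMap.ker (coverMap g (syzygy g M i))),
      inferInstanceAs (IsNoetherian Rᵐᵒᵖ (LinearMap.ker (coverMap g (syzygy g M i))))⟩

variable {g : R} (hg : IsIdempotentElem g) (M : NoetherianModule Rᵐᵒᵖ)

/-- The terms of the complex of modules `(gR)ⁿ` determined by the iterated kernels. -/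
abbrev syzygyCover (g : R) (M : NoetherianModule Rᵐᵒᵖ) (i : ℕ) : Type u :=
  Fin (coverRank g (syzygy g M i)) → rightIdeal g

/-- The inclusion of the next kernel. -/
def syzygyInclusion (g : R) (M : NoetherianModule Rᵐᵒᵖ) (i : ℕ) :
    (syzygy g M (i + 1)).1 →ₗ[Rᵐᵒᵖ] syzygyCover g M i :=
  (LinearMap.ker (coverMap g (syzygy g M i))).subtype

/-- The differential of the complex of modules `(gR)ⁿ`. -/
def syzygyD (g : R) (M : NoetherianModule Rᵐᵒᵖ) (i : ℕ) :
    syzygyCover g M (i + 1) →ₗ[Rᵐᵒᵖ] syzygyCover g M i :=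
  syzygyInclusion g M i ∘ₗ coverMap g (syzygy g M (i + 1))

theorem exists_cornerMap_coverMap_eq (i : ℕ) (x : cornerSubgroup (syzygy g M i).1 g) :
    ∃ y, cornerMap hg (coverMap g (syzygy g M i)) y = x := by
  obtain ⟨y, hy⟩ := op_smul_mem_range_coverMap g (syzygy g M i) x.1
  refine ⟨⟨op g • y, op_smul_mem_cornerSubgroup g y⟩, Subtype.ext ?_⟩
  rw [coe_cornerMap]
  change coverMap g (syzygy g M i) (op g • y) = _
  have hx := (mem_cornerSubgroup_iff hg).1 x.2
  rw [map_smul, hy, hx, hx]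

theorem exists_cornerMap_syzygyD_eq (i : ℕ) {x : cornerSubgroup (syzygyCover g M i) g}
    (hx : coverMap g (syzygy g M i) x.1 = 0) :
    ∃ y, cornerMap hg (syzygyD g M i) y = x := by
  obtain ⟨y, hy⟩ := exists_cornerMap_coverMap_eq hg M (i + 1)
    ⟨⟨x.1, hx⟩, (mem_cornerSubgroup_iff hg).2 (Subtype.ext ((mem_cornerSubgroup_iff hg).1 x.2))⟩
  exact ⟨y, Subtype.ext (congrArg (fun z : cornerSubgroup (syzygy g M (i + 1)).1 g =>
    syzygyInclusion g M i z.1) hy)⟩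

theorem coverMap_syzygyD (i : ℕ) (x : syzygyCover g M (i + 1)) :
    coverMap g (syzygy g M i) (syzygyD g M i x) = 0 :=
  (coverMap g (syzygy g M (i + 1)) x).2

theorem coverMap_eq_zero_of_syzygyD_eq_zero (i : ℕ) {x : syzygyCover g M (i + 1)}
    (hx : syzygyD g M i x = 0) : coverMap g (syzygy g M (i + 1)) x = 0 :=
  Subtype.ext hx

theorem syzygyD_syzygyD (i : ℕ) (x : syzygyCover g M (i + 2)) :
    syzygyD g M i (syzygyD g M (i + 1) x) = 0 := by
  change syzygyInclusion g M i (coverMap g (syzygy g M (i + 1)) (syzygyD g M (i + 1) x)) = 0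
  rw [coverMap_syzygyD, map_zero]

/-- Each cover becomes surjective after applying `(-)g`, so the complex of covers becomes a
projective resolution of `Mg` over `gRg`, and Tor is its homology after tensoring with `gRh`. -/
theorem exact_tensor_cornerMap_syzygyD (h : R) (i : ℕ)
    (hTor : Limits.IsZero (torGroup hg.Corner (cornerSubgroup M.1 g) (peirceComponent g h) (i + 1)))
    (t : BalancedTensor hg.Corner (cornerSubgroup (syzygyCover g M (i + 1)) g)
      (peirceComponent g h))
    (ht : balancedTensorMap hg.Corner (peirceComponent g h) (cornerMap hg (syzygyD g M i)) t = 0) :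
    ∃ t', balancedTensorMap hg.Corner (peirceComponent g h)
      (cornerMap hg (syzygyD g M (i + 1))) t' = t := by
  let X : ℕ → ModuleCat.{u} hg.Cornerᵐᵒᵖ := fun i =>
    ModuleCat.of _ (cornerSubgroup (syzygyCover g M i) g)
  let d : ∀ i, X (i + 1) ⟶ X i := fun i => ModuleCat.ofHom (cornerMap hg (syzygyD g M i))
  let π : X 0 ⟶ ModuleCat.of _ (cornerSubgroup M.1 g) :=
    ModuleCat.ofHom (cornerMap hg (coverMap g M))
  have : ∀ i, Projective (X i) := fun i =>
    have : Module.Projective hg.Cornerᵐᵒᵖ (cornerSubgroup (syzygyCover g M i) g) :=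
      projective_cornerSubgroup_pi hg _
    ModuleCat.projective_of_categoryTheory_projective _
  have : Epi π := (ModuleCat.epi_iff_surjective _).2 (exists_cornerMap_coverMap_eq hg M 0)
  have hd : ∀ i, d (i + 1) ≫ d i = 0 := fun i =>
    ModuleCat.hom_ext (LinearMap.ext fun x => Subtype.ext (syzygyD_syzygyD M i x.1))
  have hπ : d 0 ≫ π = 0 :=
    ModuleCat.hom_ext (LinearMap.ext fun x => Subtype.ext (coverMap_syzygyD M 0 x.1))
  have hex : ∀ i, (ShortComplex.mk _ _ (hd i)).Exact := fun i =>
    (ShortComplex.moduleCat_exact_iff _).2 fun x hx => exists_cornerMap_syzygyD_eq hg M (i + 1)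
      (coverMap_eq_zero_of_syzygyD_eq_zero M i (congrArg Subtype.val hx))
  have hex₀ : (ShortComplex.mk _ _ hπ).Exact :=
    (ShortComplex.moduleCat_exact_iff _).2 fun x hx => exists_cornerMap_syzygyD_eq hg M 0
      (congrArg Subtype.val hx)
  exact (ShortComplex.moduleCat_exact_iff _).1
    (exact_map_of_isZero_leftDerived hd hπ hex hex₀
      (tensorFunctor hg.Corner (peirceComponent g h)) i hTor) t ht

/-- The image always contains the `g`-part. An element of the `h`-part corresponds, through the
action map on `(gR)ⁿg ⊗ gRh`, to a cycle of the tensored complex, which is a boundary because Tor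
vanishes. The indices differ by one because the syzygy with index `i + 2` consists of the cycles in
the cover with index `i + 1`. -/
theorem surjective_coverMap_of_isZero_torGroup {h : R} (hh : IsIdempotentElem h) (hgh : g + h = 1)
    (i : ℕ)
    (hTor : Limits.IsZero
      (torGroup hg.Corner (cornerSubgroup M.1 g) (peirceComponent g h) (i + 1))) :
    Function.Surjective (coverMap g (syzygy g M (i + 2))) := by
  rw [← LinearMap.range_eq_top, eq_top_iff]
  intro x _
  have hx : x = op g • x + op h • x := by
    rw [← add_smul, ← MulOpposite.op_add, hgh, op_one, one_smul]
  rw [hx]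
  refine add_mem (op_smul_mem_range_coverMap g _ x) ?_
  obtain ⟨t, ht⟩ := exists_cornerAction_eq hg h (coverRank g (syzygy g M (i + 1)))
    (x := syzygyInclusion g M (i + 1) (op h • x)) (by
      rw [← map_smul, ← mul_smul, ← op_mul, hh.eq])
  obtain ⟨t', rfl⟩ := exact_tensor_cornerMap_syzygyD hg M h i hTor t (by
    apply cornerAction_injective hg h hh
    rw [cornerAction_map, ht, map_zero]
    change syzygyInclusion g M i (coverMap g (syzygy g M (i + 1)) (op h • x).1) = 0
    rw [(op h • x).2, map_zero])
  rw [cornerAction_map] at ht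
  exact ⟨_, Subtype.ext ht⟩

end Syzygy

/-! ### Modules over `R/⟨g⟩` and finite length. -/

section FiniteLength

variable {R : Type u} [Ring R]

/-- The action on `M` factors through `R/⟨g⟩`, and finitely generated modules over a right artinian
ring are artinian. The identity of `M`, semilinear over the quotient map, transports this back to
`R`. -/
theorem isArtinian_of_op_smul_eq_zero {g : R} (hart : IsArtinianRing (QuotientByTwoSided g)ᵐᵒᵖ)
    {M : Type*} [AddCommGroup M] [Module Rᵐᵒᵖ M] [Module.Finite Rᵐᵒᵖ M]
    (hM : ∀ m : M, op g • m = 0) : IsArtinian Rᵐᵒᵖ M := by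
  let f : R →+* (AddMonoid.End M)ᵐᵒᵖ :=
    (RingHom.op (Module.toAddMonoidEnd Rᵐᵒᵖ M)).comp (RingEquiv.opOp R).toRingHom
  have hf : (TwoSidedIdeal.span {g}).ringCon ≤ RingCon.ker f := by
    have : TwoSidedIdeal.span {g} ≤ TwoSidedIdeal.ker f := by
      rw [TwoSidedIdeal.span_le, Set.singleton_subset_iff]
      exact (TwoSidedIdeal.mem_ker f).2 (unop_injective (AddMonoidHom.ext hM))
    exact fun x y h => TwoSidedIdeal.ringCon_le_iff.1 this h
  let F : (QuotientByTwoSided g)ᵐᵒᵖ →+* AddMonoid.End M :=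
    (RingEquiv.opOp (AddMonoid.End M)).symm.toRingHom.comp (RingHom.op (RingCon.lift _ f hf))
  let : Module (QuotientByTwoSided g)ᵐᵒᵖ M := Module.compHom M F
  let σ : Rᵐᵒᵖ →+* (QuotientByTwoSided g)ᵐᵒᵖ := RingHom.op (TwoSidedIdeal.span {g}).ringCon.mk'
  have : RingHomSurjective σ := ⟨fun x => by
    obtain ⟨r, hr⟩ := Quotient.exists_rep x.unop
    exact ⟨op r, unop_injective hr⟩⟩
  let l : M →ₛₗ[σ] M :=
    { toFun := id
      map_add' := fun _ _ => rfl
      map_smul' := fun _ _ => rfl }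
  have : Module.Finite (QuotientByTwoSided g)ᵐᵒᵖ M :=
    Module.Finite.of_surjective l Function.surjective_id
  exact (LinearMap.isArtinian_iff_of_bijective l Function.bijective_id).2 inferInstance

theorem isFiniteLength_of_op_smul_eq_zero [IsNoetherianRing Rᵐᵒᵖ] {g : R}
    (hart : IsArtinianRing (QuotientByTwoSided g)ᵐᵒᵖ)
    {M : Type*} [AddCommGroup M] [Module Rᵐᵒᵖ M] [Module.Finite Rᵐᵒᵖ M]
    (hM : ∀ m : M, op g • m = 0) : IsFiniteLength Rᵐᵒᵖ M :=
  isFiniteLength_iff_isNoetherian_isArtinian.2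
    ⟨inferInstance, isArtinian_of_op_smul_eq_zero hart hM⟩

theorem exists_isSimpleModule_submodule {A M : Type*} [Ring A] [AddCommGroup M] [Module A M]
    [IsArtinian A M] [Nontrivial M] : ∃ N : Submodule A M, IsSimpleModule A N := by
  obtain ⟨N, hN, -⟩ := (IsAtomic.eq_bot_or_exists_atom_le (⊤ : Submodule A M)).resolve_left
    top_ne_bot
  exact ⟨N, isSimpleModule_iff_isAtom.2 hN⟩

end FiniteLength

/-! ### The distinguished simple module. -/

section Main

variable {R : Type u} [Ring R]

/-- A homomorphism `gR → V` is determined by the image of `g`, which lies in `Vg = 0`. -/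
theorem map_pi_rightIdeal_eq_zero {g : R} (hg : IsIdempotentElem g) {n : ℕ} {V : Type*}
    [AddCommGroup V] [Module Rᵐᵒᵖ V] (hV : ∀ v : V, op g • v = 0)
    (f : (Fin n → rightIdeal g) →ₗ[Rᵐᵒᵖ] V) : f = 0 := by
  refine LinearMap.pi_ext fun i x => ?_
  have hx : x = op x.1 • op g • ⟨g, self_mem_rightIdeal g⟩ := Subtype.ext (by
    change x.1 = g * g * x.1
    rw [hg.eq, (mem_rightIdeal_iff hg).1 x.2])
  rw [hx, Pi.single_smul, Pi.single_smul, map_smul, map_smul, hV, smul_zero]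
  rfl

theorem projective_rightIdeal {g : R} (hg : IsIdempotentElem g) :
    Module.Projective Rᵐᵒᵖ (rightIdeal g) := by
  have := free_mulOpposite_self R
  let s : R →ₗ[Rᵐᵒᵖ] rightIdeal g :=
    { toFun := fun x => ⟨g * x, (mem_rightIdeal_iff hg).2 (by rw [← mul_assoc, hg.eq])⟩
      map_add' := fun x y => Subtype.ext (mul_add g x y)
      map_smul' := fun r x => Subtype.ext (mul_assoc g x r.unop).symm }
  exact Module.Projective.of_split (rightIdeal g).subtype s
    (LinearMap.ext fun x => Subtype.ext ((mem_rightIdeal_iff hg).1 x.2))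

theorem projective_pi_fin {A P : Type*} [Ring A] [AddCommGroup P] [Module A P]
    [Module.Projective A P] (n : ℕ) : Module.Projective A (Fin n → P) :=
  Module.Projective.of_equiv (DFinsupp.linearEquivFunOnFintype (R := A) (M := fun _ : Fin n => P))

theorem subsingleton_ext_pi_rightIdeal {g : R} (hg : IsIdempotentElem g) (n : ℕ)
    {V : ModuleCat.{u} Rᵐᵒᵖ} (hV : ∀ v : V, op g • v = 0) (k : ℕ) :
    Subsingleton (Abelian.Ext (ModuleCat.of Rᵐᵒᵖ (Fin n → rightIdeal g)) V k) := by
  cases k with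
  | zero =>
    refine Abelian.Ext.homEquiv₀.subsingleton_congr.2 (subsingleton_of_forall_eq 0 fun f => ?_)
    exact ModuleCat.hom_ext (map_pi_rightIdeal_eq_zero hg hV f.hom)
  | succ k =>
    have := projective_rightIdeal hg
    have : Module.Projective Rᵐᵒᵖ (Fin n → rightIdeal g) := projective_pi_fin n
    exact Abelian.Ext.subsingleton_of_projective _ _ _

variable [IsNoetherianRing Rᵐᵒᵖ]

/-- `X` is a simple submodule of the last nonzero homology module of the complex of covers of `eR`.
It serves all `V` simultaneously, which lets `V` later be chosen as an `m`-dual of `X`. -/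
theorem exists_isSimpleModule_forall_eq_zero (hR : IsSemiperfectRing R) (hb : IsBasicRing R)
    {e : R} (he : IsIdempotentElem e) (he0 : e ≠ 0)
    (hart : IsArtinianRing (QuotientByTwoSided (1 - e))ᵐᵒᵖ)
    (htor : {k : ℕ | ¬ Limits.IsZero (torGroup he.one_sub.Corner
      (peirceComponent e (1 - e)) (peirceComponent (1 - e) e) k)}.Finite) :
    ∃ X : ModuleCat.{u} Rᵐᵒᵖ, IsSimpleModule Rᵐᵒᵖ X ∧ (∀ x : X, op (1 - e) • x = 0) ∧
      ∀ (V : ModuleCat.{u} Rᵐᵒᵖ) (_ : ∀ v : V, op (1 - e) • v = 0) (m : ℕ),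
        (∀ S : ModuleCat.{u} Rᵐᵒᵖ, IsSimpleModule Rᵐᵒᵖ S → (∀ s : S, op (1 - e) • s = 0) →
          ∀ k, m < k → Subsingleton (Abelian.Ext S V k)) →
        Nontrivial (Abelian.Ext X V m) → m = 0 := by
  set g := 1 - e with hg_def
  have hg : IsIdempotentElem g := he.one_sub
  have hge : g + e = 1 := sub_add_cancel 1 e
  let M : NoetherianModule Rᵐᵒᵖ := ⟨ModuleCat.of Rᵐᵒᵖ (rightIdeal e),
    inferInstanceAs (IsNoetherian Rᵐᵒᵖ (rightIdeal e))⟩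
  let φ := fun i => coverMap g (syzygy g M i)
  let H := fun i => (syzygy g M i).1 ⧸ LinearMap.range (φ i)
  have hH : ∀ i (x : H i), op g • x = 0 := fun i x => by
    obtain ⟨x, rfl⟩ := Submodule.Quotient.mk_surjective _ x
    exact (Submodule.Quotient.mk_eq_zero _).2 (op_smul_mem_range_coverMap g _ x)
  have hfin : ∀ i, Module.Finite Rᵐᵒᵖ (H i) := fun i =>
    have := (syzygy g M i).2
    inferInstance
  have hlen : ∀ i, IsFiniteLength Rᵐᵒᵖ (H i) := fun i =>
    isFiniteLength_of_op_smul_eq_zero hart (hH i)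
  -- Otherwise `S_e ≠ 0` would be a quotient of `(gR)ⁿ`, which has no nonzero map to a module killed
  -- by `g`.
  have hH0 : ¬ Function.Surjective (φ 0) := fun h => by
    have := nontrivial_topModule he0
    obtain ⟨y, hy⟩ := exists_ne (0 : topModule e)
    let p : rightIdeal e →ₗ[Rᵐᵒᵖ] topModule e := (Module.jacobson Rᵐᵒᵖ (rightIdeal e)).mkQ
    obtain ⟨x, rfl⟩ := (Submodule.mkQ_surjective _ : Function.Surjective p) y
    obtain ⟨z, rfl⟩ := h x
    exact hy (LinearMap.congr_fun
      (map_pi_rightIdeal_eq_zero hg (op_smul_topModule_eq_zero hR hb he) (p ∘ₗ φ 0)) z)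
  have hsurj : ∃ K, ∀ i, K < i → Function.Surjective (φ i) := by
    obtain ⟨K, hK⟩ := htor.bddAbove
    refine ⟨K + 2, fun i hi => ?_⟩
    obtain ⟨i, rfl⟩ := Nat.exists_eq_add_of_le' (by lia : 2 ≤ i)
    refine surjective_coverMap_of_isZero_torGroup hg M he hge i ?_
    have h0 : Limits.IsZero (torGroup hg.Corner (peirceComponent e g) (peirceComponent g e)
        (i + 1)) := by
      by_contra hn
      have := hK hn
      lia
    exact h0.of_iso (((tensorFunctor hg.Corner (peirceComponent g e)).leftDerived (i + 1)).mapIso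
      (cornerRightIdealEquiv he hg).toModuleIso)
  obtain ⟨K, hK⟩ := hsurj
  classical
  set d := Nat.findGreatest (fun i => ¬ Function.Surjective (φ i)) K with hd
  have hd1 : ¬ Function.Surjective (φ d) :=
    Nat.findGreatest_spec (P := fun i => ¬ Function.Surjective (φ i)) (Nat.zero_le K) hH0
  have hd2 : ∀ i, d < i → Function.Surjective (φ i) := fun i hi => by
    by_cases hiK : i ≤ K
    · exact not_not.1 (Nat.findGreatest_is_greatest hi hiK)
    · exact hK i (not_le.1 hiK)
  have : Nontrivial (H d) := Submodule.Quotient.nontrivial_iff.2 fun h =>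
    hd1 (LinearMap.range_eq_top.1 h)
  have : IsArtinian Rᵐᵒᵖ (H d) := isArtinian_of_op_smul_eq_zero hart (hH d)
  obtain ⟨X, hX⟩ := exists_isSimpleModule_submodule (A := Rᵐᵒᵖ) (M := H d)
  refine ⟨ModuleCat.of Rᵐᵒᵖ X, hX, fun x => Subtype.ext (hH d x.1), fun V hV m hS hnt => ?_⟩
  by_contra hm
  have hHV : ∀ i k, m < k → Subsingleton (Abelian.Ext (ModuleCat.of Rᵐᵒᵖ (H i)) V k) :=
    fun i k hk => (hlen i).subsingleton_ext (fun S hS' hS'' => hS S hS' hS'' k hk) (hH i)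
  have := projective_rightIdeal he
  have hHd := subsingleton_ext_homology (Z := fun i => (syzygy g M i).1)
    (P := fun i => ModuleCat.of Rᵐᵒᵖ (syzygyCover g M i))
    (B := fun i => ModuleCat.of Rᵐᵒᵖ (LinearMap.range (φ i)))
    (H := fun i => ModuleCat.of Rᵐᵒᵖ (H i))
    (fun i => (φ i).shortExact_ker_rangeRestrict)
    (fun i => (LinearMap.range (φ i)).shortExact_subtype_mkQ)
    (inferInstanceAs (Projective (ModuleCat.of Rᵐᵒᵖ (rightIdeal e)))) (V := V) (m := m) (d := d)
    (fun i k => subsingleton_ext_pi_rightIdeal hg _ hV k) hHV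
    (fun i k hi => by
      have : Subsingleton (H i) := Submodule.Quotient.subsingleton_iff.2
        (LinearMap.range_eq_top.2 (hd2 i hi))
      exact (ModuleCat.isZero_of_subsingleton (ModuleCat.of Rᵐᵒᵖ (H i))).subsingleton_ext V k)
    (by lia)
  -- `Ext^m(X, V)` sits between `Ext^m(H d, V)` and `Ext^{m+1}(H d / X, V)`; the latter vanishes by
  -- finite length.
  refine not_subsingleton_iff_nontrivial.2 hnt
    (X.shortExact_subtype_mkQ.subsingleton_ext_X₁ V m hHd ?_)
  refine ((hlen d).of_surjective X.mkQ_surjective).subsingleton_ext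
    (fun S hS' hS'' => hS S hS' hS'' _ (Nat.lt_succ_self m)) fun x => ?_
  obtain ⟨x, rfl⟩ := X.mkQ_surjective x
  rw [← map_smul, hH, map_zero]

end Main

/-! ### Graded Loewy length in terms of Ext from a simple summand. -/

section Yoneda

variable {A : Type u} [Ring A] {M S : ModuleCat.{u} A}

theorem yoneda_zero_smul (f : YonedaComponent M 0) {k : ℕ} (y : YonedaComponent M k) :
    f • y = Abelian.Ext.comp f y (zero_add k) := by
  have h : (GradedMonoid.mk k (f • y) : GradedMonoid (YonedaComponent M)) =
      GradedMonoid.mk k (Abelian.Ext.comp f y (zero_add k)) :=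
    (GradedMonoid.mk_zero_smul f y).trans (yoneda_mk_comp M f y (zero_add k))
  exact eq_of_heq (Sigma.mk.inj h).2

open scoped DirectSum in
/-- The ring structure on the degree `0` part of a graded ring. -/
abbrev gradeZeroSemiring (𝒜 : ℕ → Type*) [∀ i, AddCommMonoid (𝒜 i)] [DirectSum.GSemiring 𝒜] :
    Semiring (𝒜 0) := inferInstance

instance (priority := low) yonedaZeroSemiring : Semiring (YonedaComponent M 0) :=
  gradeZeroSemiring (YonedaComponent M)

theorem yoneda_zero_mul (f g : YonedaComponent M 0) :
    f * g = Abelian.Ext.comp f g (zero_add 0) :=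
  yoneda_zero_smul f g

/-- The idempotent of `End M` given by a direct summand of `M`. -/
def retractIdempotent (r : Retract S M) : YonedaComponent M 0 :=
  Abelian.Ext.mk₀ (r.r ≫ r.i)

/-- Composition with the inclusion and the retraction identifies `f Ext^k(M, M)` with `Ext^k(S, M)`,
where `f` is the idempotent with image `S`. -/
theorem exists_retractIdempotent_smul_ne_zero_iff (r : Retract S M) {k : ℕ} :
    (∃ y : YonedaComponent M k, retractIdempotent r • y ≠ 0) ↔
      Nontrivial (Abelian.Ext S M k) := by
  have hsmul : ∀ y : YonedaComponent M k, retractIdempotent r • y =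
      (Abelian.Ext.mk₀ r.r).comp ((Abelian.Ext.mk₀ r.i).comp y (zero_add k)) (zero_add k) :=
    fun y => by
      rw [yoneda_zero_smul, retractIdempotent, Abelian.Ext.mk₀_comp_mk₀_assoc]
  constructor
  · rintro ⟨y, hy⟩
    refine ⟨(Abelian.Ext.mk₀ r.i).comp y (zero_add k), 0, fun h => hy ?_⟩
    rw [hsmul, h, Abelian.Ext.comp_zero]
  · intro _
    obtain ⟨z, hz⟩ := exists_ne (0 : Abelian.Ext S M k)
    have hri : (Abelian.Ext.mk₀ r.i).comp ((Abelian.Ext.mk₀ r.r).comp z (zero_add k))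
        (zero_add k) = z := by
      rw [Abelian.Ext.mk₀_comp_mk₀_assoc, r.retract, Abelian.Ext.mk₀_id_comp]
    refine ⟨(Abelian.Ext.mk₀ r.r).comp z (zero_add k), fun h => hz ?_⟩
    rw [hsmul, hri] at h
    rw [← hri, h, Abelian.Ext.comp_zero]

/-- Idempotent summands of `f` correspond to idempotents of `End S`, and by Schur's lemma these are
only `0` and `1`. -/
theorem isPrimitiveIdempotent_retractIdempotent (r : Retract S M) [IsSimpleModule A S] :
    IsPrimitiveIdempotent (retractIdempotent r) := by
  have hne : retractIdempotent r ≠ 0 := fun h => by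
    have h0 : r.r ≫ r.i = 0 := (Abelian.Ext.mk₀_eq_zero_iff _).1 h
    have h1 : 𝟙 S = 0 := by
      calc 𝟙 S = (r.i ≫ r.r) ≫ r.i ≫ r.r := by rw [r.retract, Category.id_comp]
        _ = r.i ≫ (r.r ≫ r.i) ≫ r.r := by simp only [Category.assoc]
        _ = 0 := by rw [h0, Limits.zero_comp, Limits.comp_zero]
    have := IsSimpleModule.nontrivial A S
    exact not_subsingleton S (ModuleCat.subsingleton_of_isZero
      ((Limits.IsZero.iff_id_eq_zero S).2 h1))
  have mk_mul : ∀ α β : M ⟶ M, (Abelian.Ext.mk₀ α * Abelian.Ext.mk₀ β : YonedaComponent M 0) =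
      Abelian.Ext.mk₀ (α ≫ β) := fun α β => by
    rw [yoneda_zero_mul, Abelian.Ext.mk₀_comp_mk₀]
  refine ⟨?_, hne, ?_⟩
  · change retractIdempotent r * retractIdempotent r = retractIdempotent r
    rw [retractIdempotent, mk_mul, Category.assoc, r.retract_assoc]
  · intro a b ha hb hab hba hf
    have hfa : retractIdempotent r * a = a := by rw [hf, add_mul, ha.eq, hba, add_zero]
    have haf : a * retractIdempotent r = a := by rw [hf, mul_add, ha.eq, hab, add_zero]
    obtain ⟨α, rfl⟩ := Abelian.Ext.mk₀_bijective M M |>.2 a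
    have inj : Function.Injective (Abelian.Ext.mk₀ (X := M) (Y := M)) :=
      (Abelian.Ext.mk₀_bijective M M).1
    have haa : α ≫ α = α := inj (by rw [← mk_mul]; exact ha.eq)
    have hfa' : (r.r ≫ r.i) ≫ α = α := inj (by rw [← mk_mul]; exact hfa)
    have haf' : α ≫ r.r ≫ r.i = α := inj (by rw [← mk_mul]; exact haf)
    set γ : S ⟶ S := r.i ≫ α ≫ r.r with hγ
    have hαγ : r.r ≫ γ ≫ r.i = α := by
      rw [hγ, Category.assoc, Category.assoc, haf', ← Category.assoc, hfa']
    have hγγ : γ ≫ γ = γ := by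
      rw [hγ, Category.assoc, Category.assoc, ← Category.assoc r.r, ← Category.assoc (r.r ≫ r.i),
        hfa', ← Category.assoc α, haa]
    rcases LinearMap.bijective_or_eq_zero γ.hom with h | h
    · right
      have h1 : γ = 𝟙 S := ModuleCat.hom_ext (LinearMap.ext fun x => h.1
        (LinearMap.congr_fun (ModuleCat.hom_ext_iff.1 hγγ) x))
      rw [h1, Category.id_comp] at hαγ
      rw [retractIdempotent, hαγ] at hf
      exact left_eq_add.1 hf
    · left
      have h1 : γ = 0 := ModuleCat.hom_ext h
      rw [← hαγ, h1, Limits.zero_comp, Limits.comp_zero, Abelian.Ext.mk₀_zero]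

/-- Degree `k` contributes `k + 1` to the length, so the top degree is `n - 1`. The subtraction does
not truncate: `f` itself is nonzero in degree `0`, whence `n ≥ 1`. -/
theorem gradedLoewyLength_retractIdempotent (r : Retract S M) [IsSimpleModule A S] {n : ℕ}
    (hn : gradedLoewyLength (YonedaComponent M) (retractIdempotent r) = n) :
    Nontrivial (Abelian.Ext S M (n - 1)) ∧
      ∀ k, n - 1 < k → Subsingleton (Abelian.Ext S M k) := by
  have hle : ∀ k, Nontrivial (Abelian.Ext S M k) → k + 1 ≤ n := fun k hk => by
    obtain ⟨y, hy⟩ := (exists_retractIdempotent_smul_ne_zero_iff r).2 hk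
    have : ((k + 1 : ℕ) : ℕ∞) ≤ n := by
      rw [← hn]
      exact le_sSup ⟨k, y, hy, by push_cast; rfl⟩
    exact_mod_cast this
  have hf := isPrimitiveIdempotent_retractIdempotent r
  have h0 : 1 ≤ n := hle 0 ((exists_retractIdempotent_smul_ne_zero_iff r).1
    ⟨retractIdempotent r, by
      rw [yoneda_zero_smul, ← yoneda_zero_mul, hf.isIdempotentElem.eq]
      exact hf.ne_zero⟩)
  constructor
  · by_contra hnt
    have : (n : ℕ∞) ≤ (n - 1 : ℕ) := by
      rw [← hn]
      refine sSup_le ?_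
      rintro _ ⟨k, y, hy, rfl⟩
      have hk := (exists_retractIdempotent_smul_ne_zero_iff r).1 ⟨y, hy⟩
      have h1 := hle k hk
      have h2 : k ≠ n - 1 := fun h => hnt (h ▸ hk)
      have h3 : k + 1 ≤ n - 1 := by lia
      exact_mod_cast h3
    have : n ≤ n - 1 := by exact_mod_cast this
    lia
  · intro k hk
    by_contra h
    have := hle k (not_subsingleton_iff_nontrivial.1 h)
    lia

end Yoneda

/-! ### The supremum `m(M, N)` as an attained natural number. -/

section ExtSup

variable {A : Type u} [Ring A] {M N : ModuleCat.{u} A}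

theorem le_extSup {k : ℕ} (h : Nontrivial (Abelian.Ext M N k)) :
    (k : WithBot ℕ∞) ≤ extSup M N :=
  le_sSup ⟨k, h, rfl⟩

theorem subsingleton_ext_of_extSup_le {m k : ℕ} (h : extSup M N ≤ (m : WithBot ℕ∞)) (hk : m < k) :
    Subsingleton (Abelian.Ext M N k) := by
  by_contra hn
  have := (le_extSup (not_subsingleton_iff_nontrivial.1 hn)).trans h
  have : k ≤ m := by exact_mod_cast this
  lia

theorem exists_extSup_eq {m : ℕ} (h : extSup M N ≤ (m : WithBot ℕ∞)) (h0 : 0 ≤ extSup M N) :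
    ∃ k : ℕ, extSup M N = (k : WithBot ℕ∞) ∧ Nontrivial (Abelian.Ext M N k) := by
  set T := {k : ℕ | Nontrivial (Abelian.Ext M N k)} with hT
  have hne : T.Nonempty := by
    by_contra hn
    rw [Set.not_nonempty_iff_eq_empty] at hn
    have : extSup M N ≤ ⊥ := sSup_le (by
      rintro _ ⟨k, hk, rfl⟩
      exact absurd (hn ▸ hk : k ∈ (∅ : Set ℕ)) (Set.notMem_empty k))
    exact absurd (h0.trans this) (by simp)
  have hbdd : BddAbove T := ⟨m, fun k hk => by exact_mod_cast (le_extSup hk).trans h⟩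
  refine ⟨sSup T, le_antisymm (sSup_le ?_) (le_extSup (Nat.sSup_mem hne hbdd)),
    Nat.sSup_mem hne hbdd⟩
  rintro _ ⟨k, hk, rfl⟩
  change (k : WithBot ℕ∞) ≤ (sSup T : ℕ)
  exact_mod_cast le_csSup hbdd hk

theorem zero_le_extSup_self (h : ¬ Limits.IsZero M) : 0 ≤ extSup M M :=
  le_extSup (k := 0) ⟨Abelian.Ext.mk₀ (𝟙 M), 0, fun h' =>
    h ((Limits.IsZero.iff_id_eq_zero M).2 ((Abelian.Ext.mk₀_eq_zero_iff _).1 h'))⟩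

end ExtSup

theorem ModuleCat.not_isZero_of_nontrivial {A : Type u} [Ring A] (M : ModuleCat.{u} A)
    [Nontrivial M] : ¬ Limits.IsZero M := fun h =>
  not_subsingleton M (ModuleCat.subsingleton_of_isZero h)

end

theorem mainTheorem3 {R : Type u} [Ring R]
    (hsemiperfect : IsSemiperfectRing R)
    (hleft : IsNoetherianRing R) (hright : IsNoetherianRing Rᵐᵒᵖ)
    (hbasic : IsBasicRing R)
    (e : R) (he : IsIdempotentElem e) (he0 : e ≠ 0)
    (hart : IsArtinianRing (QuotientByTwoSided (1 - e))ᵐᵒᵖ)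
    (hm : HasMProperty (addClosure (topModule e)))
    (htor : {k : ℕ | ¬ Limits.IsZero (torGroup he.one_sub.Corner
      (peirceComponent e (1 - e)) (peirceComponent (1 - e) e) k)}.Finite) :
    (∃ S : ModuleCat.{u} Rᵐᵒᵖ, addClosure (topModule e) S ∧ ¬ Limits.IsZero S ∧
      ∀ k : ℕ, 0 < k → Subsingleton (Abelian.Ext (topModule e) S k)) ∧
    (HasUniformlyGradedLoewyLength (YonedaComponent (topModule e)) →
      addClosure (topModule e) (topModule e) ∧ ¬ Limits.IsZero (topModule e) ∧
        ∀ k : ℕ, 0 < k → Subsingleton (Abelian.Ext (topModule e) (topModule e) k)) := by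
  obtain ⟨X, hX, hXe, key⟩ :=
    exists_isSimpleModule_forall_eq_zero hsemiperfect hbasic he he0 hart htor
  have hS : ∀ v : topModule e, op (1 - e) • v = 0 :=
    op_smul_topModule_eq_zero hsemiperfect hbasic he
  have hretract : ∀ S : ModuleCat.{u} Rᵐᵒᵖ, IsSimpleModule Rᵐᵒᵖ S → (∀ s : S, op (1 - e) • s = 0) →
      Nonempty (Retract S (topModule e)) := fun S _ hS =>
    exists_retract_topModule hsemiperfect hbasic he S hS
  have hself : addClosure (topModule e) (topModule e) := addClosure_of_retract (Retract.refl _)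
  obtain ⟨rX⟩ := hretract X hX hXe
  constructor
  · obtain ⟨⟨N, hN⟩, hdual⟩ := hm
    have := IsSimpleModule.nontrivial Rᵐᵒᵖ X
    obtain ⟨X', hX'0, hX', hmax⟩ := hdual X (addClosure_of_retract rX) X.not_isZero_of_nontrivial
    -- The identity of `X'` gives `0 ≤ m(X', X') ≤ m(X, X')`, so the bounded supremum is attained in
    -- some degree `m`.
    obtain ⟨m, hm, hnt⟩ := exists_extSup_eq (hN X X' (addClosure_of_retract rX) hX')
      ((zero_le_extSup_self hX'0).trans (hmax X' hX'))
    rw [hm] at hmax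
    -- Duality bounds `m(S, X')` by `m = m(X, X')` for every simple `S` killed by `1 - e`, which is
    -- the hypothesis of `key`.
    obtain rfl := key X' (smul_eq_zero_of_addClosure hX' hS) m (fun S hS hSe k hk => by
      obtain ⟨r⟩ := hretract S hS hSe
      exact subsingleton_ext_of_extSup_le (hmax S (addClosure_of_retract r)) hk) hnt
    exact ⟨X', hX', hX'0, fun k hk => subsingleton_ext_of_extSup_le (hmax _ hself) hk⟩
  · rintro ⟨n, hn⟩
    have := nontrivial_topModule he0
    have hsimple : ∀ S : ModuleCat.{u} Rᵐᵒᵖ, IsSimpleModule Rᵐᵒᵖ S →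
        (∀ s : S, op (1 - e) • s = 0) → Nontrivial (Abelian.Ext S (topModule e) (n - 1)) ∧
          ∀ k, n - 1 < k → Subsingleton (Abelian.Ext S (topModule e) k) := fun S hS hSe => by
      obtain ⟨r⟩ := hretract S hS hSe
      exact gradedLoewyLength_retractIdempotent r
        (hn _ (isPrimitiveIdempotent_retractIdempotent r))
    -- All simple modules killed by `1 - e` share the top degree `n - 1` of Ext into `S_e`, so `X`
    -- attains it as well and it must be `0`.
    have h0 := key (topModule e) hS (n - 1) (fun S hS hSe => (hsimple S hS hSe).2)
      (hsimple X hX hXe).1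
    refine ⟨hself, ModuleCat.not_isZero_of_nontrivial _, fun k hk => ?_⟩
    exact (isFiniteLength_of_op_smul_eq_zero hart hS).subsingleton_ext
      (fun S hS hSe => (hsimple S hS hSe).2 k (h0 ▸ hk)) hS
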